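/- For $U\in\mathrm U(4)$, the ironed gadget of $U$ is the random two-qubit unitary $V=(A_1\otimes A_2)\,U\,(B_1\otimes B_2)$ with $A_1,A_2,B_1,B_2$ independent Haar-random elements of $\mathrm U(2)$, and $T_2^{U}=\mathbb E\big[V^{\otimes 2}\otimes\bar V^{\otimes 2}\big]$ is its second moment operator. For a connected graph $\mathcal G$ on $n$ qubits let $$T_{2,\mathcal G}^{U}=\frac1{|E(\mathcal G)|}\sum_{(i,j)\in E(\mathcal G)}T_{2,(i,j)}^{U},$$ where $T_{2,(i,j)}^{U}$ is the second moment operator of the gadget applied to qubits $i,j$ (and the identity on the other qubits). The spectral gap of a Hermitian second moment operator $T$ is $\Delta(T)=1-\max\{\lambda_2(T),|\lambda_{\min}(T)|\}$, where $\lambda_{\min}(T)$ is the smallest eigenvalue and $\lambda_2(T)$ is the largest eigenvalue of $T$ on the orthogonal complement of the commutant $\{M: W^{\otimes2}M=MW^{\otimes2}\text{ for all unitary }W\}$, on which every second moment operator is the identity. Real numbers $k_x,k_y,k_z$ are KAK coefficients of $U$ if $U=(A_1\otimes A_2)\exp[i(k_xX\otimes X+k_yY\otimes Y+k_zZ\otimes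 Z)](B_1\otimes B_2)$ for some $A_i,B_i\in\mathrm U(2)$; $\mathrm{iSWAP}$ is the gate $\exp[i\frac\pi4(X\otimes X+Y\otimes Y)]$, with KAK coefficients $(\frac\pi4,\frac\pi4,0)$. Put $$a=\tfrac19\Big(6+\sum\cos 4k\cos 4k'\Big),\qquad c=\tfrac1{12}\Big(3+\sum\cos4k\cos4k'-2\sum\cos4k\Big),$$ where $\sum\cos 4k=\cos4k_x+\cos4k_y+\cos4k_z$ and $\sum\cos4k\cos4k'$ is the sum over the three unordered pairs of distinct coefficients. All inequalities between operators are in the semidefinite order. **Theorem.** Let $U\in\mathrm U(4)$. 1. $T_2^{U}$ is Hermitian, and either $T_2^{U}\ge T_2^{\mathrm{iSWAP}}$ or the two operators are incomparable; in particular $T_2^{U}$ is never strictly below $T_2^{\mathrm{iSWAP}}$. 2. If $k_x,k_y,k_z$ are KAK coefficients of $U$, then $T_2^{U}\ge T_2^{\mathrm{iSWAP}}$ if and only if $$3\Big(a-\frac59\Big)-4\Big(c-\frac13\Big)=\frac23\big(1+\cos4k_x+\cos4k_y+\cos4k_z\big)\ \ge\ 0 .$$ 3. If this inequality holds, then for every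 connected graph $\mathcal G$ on $n\ge3$ qubits, $T_{2,\mathcal G}^{U}$ and $T_{2,\mathcal G}^{\mathrm{iSWAP}}$ are Hermitian and $\Delta\big(T_{2,\mathcal G}^{\mathrm{iSWAP}}\big)\ge\Delta\big(T_{2,\mathcal G}^{U}\big)$. -/

import Mathlib

open scoped Kronecker MatrixOrder

namespace IronedGadget

noncomputable section

/-! ### Haar measure on the one-qubit unitary group -/

/-- The compact group `U(2)`. -/
abbrev U2 : Type := Matrix.unitaryGroup (Fin 2) ℂ

instance : MeasurableSpace U2 := borel U2

instance : BorelSpace U2 := ⟨rfl⟩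

instance : CompactSpace U2 := by
  refine (isCompact_iff_compactSpace
    (s := (Matrix.unitaryGroup (Fin 2) ℂ : Set (Matrix (Fin 2) (Fin 2) ℂ)))).mp ?_
  have hcl : IsClosed (Matrix.unitaryGroup (Fin 2) ℂ : Set (Matrix (Fin 2) (Fin 2) ℂ)) := by
    have h : (Matrix.unitaryGroup (Fin 2) ℂ : Set (Matrix (Fin 2) (Fin 2) ℂ))
        = {A | A * star A = 1} := by
      ext A
      exact Matrix.mem_unitaryGroup_iff
    rw [h]
    exact isClosed_eq (by fun_prop) continuous_const
  have hK : IsCompact (Set.pi Set.univ fun _ : Fin 2 => Set.pi Set.univ fun _ : Fin 2 =>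
      Metric.closedBall (0 : ℂ) 1) :=
    isCompact_univ_pi fun _ => isCompact_univ_pi fun _ => isCompact_closedBall 0 1
  refine IsCompact.of_isClosed_subset hK hcl ?_
  intro A hA i _ j _
  simpa using entry_norm_bound_of_unitary hA i j

/-- The Haar probability measure on `U(2)`. -/
def haarU2 : MeasureTheory.Measure U2 :=
  MeasureTheory.Measure.haarMeasure ⟨⟨Set.univ, isCompact_univ⟩, by simp⟩

/-! ### Moment operators -/

/-- The `t`-fold tensor power `V^{⊗ t}` of a matrix `V`. -/
def tensorPow (t : ℕ) {ι : Type*} (V : Matrix ι ι ℂ) : Matrix (Fin t → ι) (Fin t → ι) ℂ :=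
  Matrix.of fun x y => ∏ s, V (x s) (y s)

/-- The `t`-th moment operator `∫ V^{⊗ t} ⊗ conj(V)^{⊗ t} dμ` of the random matrix `V`. A vector
`w` in the space it acts on stands for the operator with matrix entries `M x y = w (x, y)`, and the
operator is then `M ↦ ∫ V^{⊗ t} M (V^{⊗ t})† dμ`. -/
def momentOp (t : ℕ) {ι Ω : Type*} [MeasurableSpace Ω] (μ : MeasureTheory.Measure Ω)
    (V : Ω → Matrix ι ι ℂ) :
    Matrix ((Fin t → ι) × (Fin t → ι)) ((Fin t → ι) × (Fin t → ι)) ℂ :=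
  Matrix.of fun p q => ∫ ω, (tensorPow t (V ω) ⊗ₖ (tensorPow t (V ω)).map star) p q ∂μ

/-- The commutant `{M : V^{⊗ t} M = M V^{⊗ t} for all unitary V}`, which is the range (the unit
eigenspace) of the `t`-th moment operator of the Haar measure. -/
def commutant (t : ℕ) (ι : Type*) [Fintype ι] [DecidableEq ι] :
    Set (Matrix (Fin t → ι) (Fin t → ι) ℂ) :=
  {M | ∀ V ∈ Matrix.unitaryGroup ι ℂ, tensorPow t V * M = M * tensorPow t V}

section Gap

variable (t : ℕ) {ι : Type*} [Fintype ι] [DecidableEq ι]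
  (T : Matrix ((Fin t → ι) × (Fin t → ι)) ((Fin t → ι) × (Fin t → ι)) ℂ)

/-- The second largest eigenvalue of a Hermitian moment operator: every moment operator of unitaries
fixes the commutant, and `lambdaTwo` is the largest eigenvalue that remains when these unit
eigenvalues (`dim commutant` many, with multiplicity) are split off, that is, the largest
eigenvalue having an eigenvector orthogonal to the commutant. -/
def lambdaTwo : ℝ :=
  sSup {r : ℝ | ∃ w : (Fin t → ι) × (Fin t → ι) → ℂ, w ≠ 0 ∧
    (∀ M ∈ commutant t ι, ∑ p, star (M p.1 p.2) * w p = 0) ∧ T.mulVec w = (r : ℂ) • w}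

/-- The smallest eigenvalue of a Hermitian moment operator. -/
def lambdaMin : ℝ :=
  sInf {r : ℝ | ∃ w : (Fin t → ι) × (Fin t → ι) → ℂ, w ≠ 0 ∧ T.mulVec w = (r : ℂ) • w}

/-- The spectral gap `1 - max {λ₂, |λ_min|}` of a Hermitian `t`-th moment operator. -/
def spectralGap : ℝ :=
  1 - max (lambdaTwo t T) |lambdaMin t T|

end Gap

/-! ### Two-qubit gates and their KAK coefficients -/

/-- Operators on two qubits. -/
abbrev Gate : Type := Matrix (Fin 2 × Fin 2) (Fin 2 × Fin 2) ℂ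

def pauliX : Matrix (Fin 2) (Fin 2) ℂ := !![0, 1; 1, 0]

def pauliY : Matrix (Fin 2) (Fin 2) ℂ := !![0, -Complex.I; Complex.I, 0]

def pauliZ : Matrix (Fin 2) (Fin 2) ℂ := !![1, 0; 0, -1]

/-- `exp[i (kx X ⊗ X + ky Y ⊗ Y + kz Z ⊗ Z)]`. -/
def kakGate (kx ky kz : ℝ) : Gate :=
  NormedSpace.exp (Complex.I • ((kx : ℂ) • (pauliX ⊗ₖ pauliX) + (ky : ℂ) • (pauliY ⊗ₖ pauliY)
    + (kz : ℂ) • (pauliZ ⊗ₖ pauliZ)))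

/-- `(kx, ky, kz)` are KAK coefficients of the two-qubit gate `U`. -/
def HasKAK (U : Gate) (kx ky kz : ℝ) : Prop :=
  ∃ A₁ A₂ B₁ B₂ : U2, U = ((A₁ : Matrix (Fin 2) (Fin 2) ℂ) ⊗ₖ (A₂ : Matrix (Fin 2) (Fin 2) ℂ))
    * kakGate kx ky kz
    * ((B₁ : Matrix (Fin 2) (Fin 2) ℂ) ⊗ₖ (B₂ : Matrix (Fin 2) (Fin 2) ℂ))

/-- The `iSWAP` gate, with KAK coefficients `(π/4, π/4, 0)`. -/
def iSWAP : Gate := kakGate (Real.pi / 4) (Real.pi / 4) 0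

/-- The function `a` of the KAK coefficients. -/
def coeffA (kx ky kz : ℝ) : ℝ :=
  (6 + Real.cos (4 * kx) * Real.cos (4 * ky) + Real.cos (4 * kx) * Real.cos (4 * kz)
    + Real.cos (4 * ky) * Real.cos (4 * kz)) / 9

/-- The function `c` of the KAK coefficients. -/
def coeffC (kx ky kz : ℝ) : ℝ :=
  (3 + Real.cos (4 * kx) * Real.cos (4 * ky) + Real.cos (4 * ky) * Real.cos (4 * kz)
    + Real.cos (4 * kz) * Real.cos (4 * kx)
    - 2 * (Real.cos (4 * kx) + Real.cos (4 * ky) + Real.cos (4 * kz))) / 12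

/-! ### Ironed gadgets -/

/-- The law of the four independent Haar-random one-qubit gates `((A₁, A₂), (B₁, B₂))`. -/
def gadgetMeasure : MeasureTheory.Measure ((U2 × U2) × (U2 × U2)) :=
  (haarU2.prod haarU2).prod (haarU2.prod haarU2)

/-- The random unitary `(A₁ ⊗ A₂) U (B₁ ⊗ B₂)` of the ironed gadget of `U`. -/
def gadgetUnitary (U : Gate) (g : (U2 × U2) × (U2 × U2)) : Gate :=
  ((g.1.1 : Matrix (Fin 2) (Fin 2) ℂ) ⊗ₖ (g.1.2 : Matrix (Fin 2) (Fin 2) ℂ)) * U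
    * ((g.2.1 : Matrix (Fin 2) (Fin 2) ℂ) ⊗ₖ (g.2.2 : Matrix (Fin 2) (Fin 2) ℂ))

/-- The two-qubit `t`-th moment operator of the ironed gadget of `U`. -/
def gadgetMoment (t : ℕ) (U : Gate) :
    Matrix ((Fin t → Fin 2 × Fin 2) × (Fin t → Fin 2 × Fin 2))
      ((Fin t → Fin 2 × Fin 2) × (Fin t → Fin 2 × Fin 2)) ℂ :=
  momentOp t gadgetMeasure (gadgetUnitary U)

/-- The two-qubit gate `V` acting on the sites `i`, `j` of an `n`-qubit register (computational
basis `Fin n → Fin 2`), tensored with the identity on the other sites. -/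
def onSites {n : ℕ} (i j : Fin n) (V : Gate) : Matrix (Fin n → Fin 2) (Fin n → Fin 2) ℂ :=
  Matrix.of fun x y =>
    if ∀ k, k ≠ i → k ≠ j → x k = y k then V (x i, x j) (y i, y j) else 0

open Classical in
/-- The edges of a graph on `n` vertices, each one listed once, as the pair `(i, j)` with `i < j`. -/
def edgePairs {n : ℕ} (G : SimpleGraph (Fin n)) : Finset (Fin n × Fin n) :=
  Finset.univ.filter fun e => e.1 < e.2 ∧ G.Adj e.1 e.2

/-- The `t`-th moment operator of the `n`-qubit ensemble which samples a uniformly random edge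
of `G` and applies the ironed gadget of `U` on it. -/
def graphMoment (t : ℕ) (U : Gate) {n : ℕ} (G : SimpleGraph (Fin n)) :
    Matrix ((Fin t → Fin n → Fin 2) × (Fin t → Fin n → Fin 2))
      ((Fin t → Fin n → Fin 2) × (Fin t → Fin n → Fin 2)) ℂ :=
  ((edgePairs G).card : ℂ)⁻¹ • ∑ e ∈ edgePairs G,
    momentOp t gadgetMeasure fun g => onSites e.1 e.2 (gadgetUnitary U g)

end

end IronedGadget

open IronedGadget

/-!
A second moment operator of an ironed gadget has the form `Π W(U) Π`, where `W(U)` is conjugation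
by `U ⊗ U` and `Π` is the twirl over local unitaries (`gadgetMoment_eq_twirl`). By Haar invariance
and the elementary commutant computation `eq_smul_add_smul_of_commute`, `Π` is the orthogonal
projection onto the span of four operators: the projections `pairAnti` and `pairSym` onto the
antisymmetric and symmetric subspaces of two copies of a qubit pair, the difference `chirality` of
the two singlet-triplet projections, and the part `singletTraceless` of the projection onto two
singlets that is orthogonal to `pairSym` (`localTwirl_eq`). Since `U ⊗ U` commutes with the
exchange of the copies, the moment operator is diagonal in this basis for every unitary `U`: it
fixes `pairAnti` and `pairSym`, and its two other eigenvalues are affine functions, with positive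
slope, of two real invariants, `chiralInvariant U` and `singletInvariant U`
(`gadgetMoment_eq_invariants`). Comparing two moment operators therefore means comparing these two
numbers (`gadgetMoment_le_iff`).

With `E` the spin flip, `singletInvariant U` is `|tr m|²` for `m = E U E Uᵀ`. Lowering indices with
`E` turns `chirality` into the Levi-Civita form on `ℂ⁴`, which `U` multiplies by `det U`; this
gives `chiralInvariant U = det U * conj ((tr m)² - tr m²) / 2` (`chiralInvariant_eq`). At `iSWAP`
the two invariants are `-2` and `0`. So `iSWAP` minimizes the singlet invariant, and a gate which
attains that minimum satisfies `tr m = 0`, whence `|chiralInvariant U| = |tr m²| / 2 ≤ 2`. This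
proves that no gate lies below `iSWAP` without lying above it, and it needs no KAK decomposition.
In the Bell basis the KAK gates are diagonal, and `chiralInvariant` is twice the sum of the `cos
4k`, so that the stated inequality is exactly `-2 ≤ chiralInvariant U`.

On a graph, each edge contributes the two-qubit moment operator tensored with the identity, so the
order passes to the averages over edges, and then to the largest eigenvalue off the commutant by a
Rayleigh quotient argument (`exists_eigenvector_ge`). It remains to see that the least eigenvalue
does not determine the gap of `iSWAP`. It is at least `-1/3`, as on two qubits. On the other hand,
the Pauli matrix `X` acting at a vertex `s` of one copy is orthogonal to the commutant, is fixed by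
the edges that avoid `s` and is annihilated by the edges at `s`; it is an eigenvector with
eigenvalue `1 - deg s / |E|`, and a graph on at least three vertices has a vertex for which this is
at least `1/3`.
-/

open Matrix MeasureTheory

namespace IronedGadget

noncomputable section

/-! ### Tensor powers and conjugation superoperators -/

section SuperOp

variable {ι : Type*} (t : ℕ)

/-- The vector that stands for the operator `M` in the space on which moment operators act. -/
def opVec {κ : Type*} (M : Matrix κ κ ℂ) : κ × κ → ℂ := fun p => M p.1 p.2

/-- The matrix of `M ↦ V^{⊗ t} M (V^{⊗ t})†`, acting on vectors `opVec M`. -/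
def superOp (V : Matrix ι ι ℂ) :
    Matrix ((Fin t → ι) × (Fin t → ι)) ((Fin t → ι) × (Fin t → ι)) ℂ :=
  tensorPow t V ⊗ₖ (tensorPow t V).map star

theorem momentOp_apply {Ω : Type*} [MeasurableSpace Ω] (μ : Measure Ω) (V : Ω → Matrix ι ι ℂ)
    (p q) : momentOp t μ V p q = ∫ ω, superOp t (V ω) p q ∂μ := rfl

theorem superOp_apply (V : Matrix ι ι ℂ) (p q : (Fin t → ι) × (Fin t → ι)) :
    superOp t V p q = (∏ s, V (p.1 s) (q.1 s)) * star (∏ s, V (p.2 s) (q.2 s)) := rfl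

theorem tensorPow_conjTranspose (A : Matrix ι ι ℂ) :
    tensorPow t Aᴴ = (tensorPow t A)ᴴ := by
  ext x y
  simp [tensorPow, conjTranspose_apply]

theorem tensorPow_transpose (A : Matrix ι ι ℂ) :
    tensorPow t Aᵀ = (tensorPow t A)ᵀ := rfl

theorem tensorPow_one [DecidableEq ι] : tensorPow t (1 : Matrix ι ι ℂ) = 1 := by
  ext x y
  by_cases h : x = y
  · subst h; simp [tensorPow]
  · obtain ⟨s, hs⟩ := Function.ne_iff.mp h
    simp only [tensorPow, of_apply, one_apply_ne h]
    exact Finset.prod_eq_zero (Finset.mem_univ s) (one_apply_ne hs)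

variable [Fintype ι]

theorem tensorPow_mul (A B : Matrix ι ι ℂ) :
    tensorPow t (A * B) = tensorPow t A * tensorPow t B := by
  classical
  ext x y
  simp only [tensorPow, of_apply, mul_apply]
  rw [Finset.prod_univ_sum]
  simp [Finset.prod_mul_distrib, Fintype.piFinset_univ]

theorem superOp_mul (A B : Matrix ι ι ℂ) : superOp t (A * B) = superOp t A * superOp t B := by
  classical
  have h : (tensorPow t A * tensorPow t B).map star
      = (tensorPow t A).map star * (tensorPow t B).map star := by
    ext x y; simp [mul_apply]
  rw [superOp, superOp, superOp, ← mul_kronecker_mul, tensorPow_mul, h]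

theorem superOp_mulVec_opVec (V : Matrix ι ι ℂ) (M : Matrix (Fin t → ι) (Fin t → ι) ℂ) :
    superOp t V *ᵥ opVec M = opVec (tensorPow t V * M * (tensorPow t V)ᴴ) := by
  classical
  ext p
  simp only [superOp, opVec, mulVec, dotProduct, kroneckerMap_apply, map_apply, mul_apply,
    conjTranspose_apply, Fintype.sum_prod_type, Finset.sum_mul]
  rw [Finset.sum_comm]
  refine Finset.sum_congr rfl fun x _ => Finset.sum_congr rfl fun y _ => by ring

theorem dotProduct_opVec {κ : Type*} [Fintype κ] (A B : Matrix κ κ ℂ) :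
    opVec A ⬝ᵥ opVec B = (Aᵀ * B).trace := by
  simp only [dotProduct, opVec, trace, diag, mul_apply, transpose_apply, Fintype.sum_prod_type]
  rw [Finset.sum_comm]

variable [DecidableEq ι]

theorem tensorPow_mul_conjTranspose {V : Matrix ι ι ℂ} (hV : V ∈ unitaryGroup ι ℂ) :
    tensorPow t V * (tensorPow t V)ᴴ = 1 := by
  rw [← tensorPow_conjTranspose, ← tensorPow_mul, ← star_eq_conjTranspose,
    mem_unitaryGroup_iff.mp hV, tensorPow_one]

theorem tensorPow_conjTranspose_mul {V : Matrix ι ι ℂ} (hV : V ∈ unitaryGroup ι ℂ) :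
    (tensorPow t V)ᴴ * tensorPow t V = 1 := by
  rw [← tensorPow_conjTranspose, ← tensorPow_mul, ← star_eq_conjTranspose,
    mem_unitaryGroup_iff'.mp hV, tensorPow_one]

theorem tensorPow_conj_of_commute {V : Matrix ι ι ℂ} (hV : V ∈ unitaryGroup ι ℂ)
    {M : Matrix (Fin t → ι) (Fin t → ι) ℂ} (h : tensorPow t V * M = M * tensorPow t V) :
    tensorPow t V * M * (tensorPow t V)ᴴ = M := by
  rw [h, Matrix.mul_assoc, tensorPow_mul_conjTranspose t hV, Matrix.mul_one]

theorem commute_of_superOp_mulVec {V : Matrix ι ι ℂ} (hV : V ∈ unitaryGroup ι ℂ)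
    {M : Matrix (Fin t → ι) (Fin t → ι) ℂ} (h : superOp t V *ᵥ opVec M = opVec M) :
    tensorPow t V * M = M * tensorPow t V := by
  rw [superOp_mulVec_opVec] at h
  have h' : tensorPow t V * M * (tensorPow t V)ᴴ = M := by
    ext x y; exact congrFun h (x, y)
  conv_rhs => rw [← h']
  rw [Matrix.mul_assoc, tensorPow_conjTranspose_mul t hV, Matrix.mul_one]

end SuperOp

/-! ### Moment operators of continuous families on compact groups -/

instance : haarU2.IsHaarMeasure := by unfold haarU2; infer_instance

instance : IsProbabilityMeasure haarU2 :=
  ⟨by unfold haarU2; exact Measure.haarMeasure_self⟩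

instance : SecondCountableTopology U2 :=
  inferInstanceAs (SecondCountableTopology
    {A : Fin 2 → Fin 2 → ℂ // A ∈ (unitaryGroup (Fin 2) ℂ : Set (Matrix (Fin 2) (Fin 2) ℂ))})


instance : (haarU2.prod haarU2).IsMulLeftInvariant := inferInstance

instance : gadgetMeasure.IsMulLeftInvariant :=
  Measure.prod.instIsMulLeftInvariant (μ := haarU2.prod haarU2) (ν := haarU2.prod haarU2)

instance : IsProbabilityMeasure gadgetMeasure := by unfold gadgetMeasure; infer_instance

theorem continuous_integrable {Ω : Type*} [TopologicalSpace Ω] [CompactSpace Ω]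
    [MeasurableSpace Ω] [OpensMeasurableSpace Ω] (μ : Measure Ω) [IsFiniteMeasure μ]
    {f : Ω → ℂ} (hf : Continuous f) : Integrable f μ :=
  hf.integrable_of_hasCompactSupport (HasCompactSupport.of_compactSpace f)

theorem continuous_superOp {Ω ι : Type*} [TopologicalSpace Ω] (t : ℕ) {V : Ω → Matrix ι ι ℂ}
    (hV : Continuous V) (p q) : Continuous fun ω => superOp t (V ω) p q := by
  simp only [superOp_apply]
  have h : ∀ i j, Continuous fun ω => V ω i j := fun i j => hV.matrix_elem i j
  fun_prop

theorem momentOp_mulVec {Ω ι : Type*} [Fintype ι] [TopologicalSpace Ω] [CompactSpace Ω]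
    [MeasurableSpace Ω] [OpensMeasurableSpace Ω] (t : ℕ) (μ : Measure Ω) [IsFiniteMeasure μ]
    {V : Ω → Matrix ι ι ℂ} (hV : Continuous V) (w) (p) :
    (momentOp t μ V *ᵥ w) p = ∫ ω, (superOp t (V ω) *ᵥ w) p ∂μ := by
  classical
  simp only [mulVec, dotProduct, momentOp_apply]
  rw [integral_finsetSum]
  · simp_rw [integral_mul_const]
  · exact fun i _ => (continuous_integrable μ (continuous_superOp t hV p i)).mul_const _

theorem momentOp_mulVec_eq {Ω ι : Type*} [Fintype ι] [TopologicalSpace Ω] [CompactSpace Ω]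
    [MeasurableSpace Ω] [OpensMeasurableSpace Ω] (t : ℕ) (μ : Measure Ω) [IsProbabilityMeasure μ]
    {V : Ω → Matrix ι ι ℂ} (hV : Continuous V) {w} (h : ∀ ω, superOp t (V ω) *ᵥ w = w) :
    momentOp t μ V *ᵥ w = w := by
  ext p
  rw [momentOp_mulVec t μ hV]
  simp [h]

/-- Left translating a random unitary by a symmetry of its law leaves the moment operator
unchanged. -/
theorem superOp_mul_momentOp {G ι : Type*} [Fintype ι] [Group G] [TopologicalSpace G]
    [IsTopologicalGroup G] [CompactSpace G] [MeasurableSpace G] [BorelSpace G] (t : ℕ)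
    (μ : Measure G) [IsFiniteMeasure μ] [μ.IsMulLeftInvariant]
    {V : G → Matrix ι ι ℂ} (hV : Continuous V) (g : G) (A : Matrix ι ι ℂ)
    (h : ∀ x, V (g * x) = A * V x) : superOp t A * momentOp t μ V = momentOp t μ V := by
  classical
  ext p q
  simp only [mul_apply, momentOp_apply]
  rw [← integral_mul_left_eq_self (fun x => superOp t (V x) p q) g]
  simp only [h, superOp_mul, mul_apply]
  rw [integral_finsetSum]
  · simp_rw [integral_const_mul]
  · exact fun i _ => (continuous_integrable μ (continuous_superOp t hV i q)).const_mul _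

theorem continuous_kron {Ω : Type*} [TopologicalSpace Ω] {A B : Ω → Matrix (Fin 2) (Fin 2) ℂ}
    (hA : Continuous A) (hB : Continuous B) : Continuous fun ω => A ω ⊗ₖ B ω := by
  refine continuous_matrix fun i j => ?_
  simp only [kroneckerMap_apply]
  exact (hA.matrix_elem _ _).mul (hB.matrix_elem _ _)

/-- The local unitary `A₁ ⊗ A₂`. -/
def localGate (g : U2 × U2) : Gate :=
  (g.1 : Matrix (Fin 2) (Fin 2) ℂ) ⊗ₖ (g.2 : Matrix (Fin 2) (Fin 2) ℂ)

theorem continuous_localGate : Continuous localGate :=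
  continuous_kron (by fun_prop) (by fun_prop)

theorem localGate_mul (g h : U2 × U2) : localGate (g * h) = localGate g * localGate h := by
  simp [localGate, mul_kronecker_mul]

theorem localGate_mem (g : U2 × U2) : localGate g ∈ unitaryGroup (Fin 2 × Fin 2) ℂ :=
  kronecker_mem_unitary g.1.2 g.2.2

theorem gadgetUnitary_eq (U : Gate) (g) :
    gadgetUnitary U g = localGate g.1 * U * localGate g.2 := rfl

theorem continuous_gadgetUnitary (U : Gate) : Continuous (gadgetUnitary U) := by
  simp only [funext (gadgetUnitary_eq U)]
  exact ((continuous_localGate.comp continuous_fst).mul continuous_const).mul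
    (continuous_localGate.comp continuous_snd)

theorem gadgetUnitary_mem {U : Gate} (hU : U ∈ unitaryGroup (Fin 2 × Fin 2) ℂ) (g) :
    gadgetUnitary U g ∈ unitaryGroup (Fin 2 × Fin 2) ℂ :=
  mul_mem (mul_mem (localGate_mem _) hU) (localGate_mem _)

/-- The moment operator of a Haar-random local unitary. -/
def localTwirl (t : ℕ) :=
  momentOp t (haarU2.prod haarU2) localGate

/-- The moment operator of the gadget is the conjugation by the gate `U`, preceded and followed by
the local twirl. -/
theorem gadgetMoment_eq_twirl (t : ℕ) (U : Gate) :
    gadgetMoment t U = localTwirl t * superOp t U * localTwirl t := by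
  ext p q
  have hi : ∀ p q, Integrable (fun g => superOp t (localGate g) p q) (haarU2.prod haarU2) :=
    fun p q => continuous_integrable _ (continuous_superOp t continuous_localGate p q)
  have h2 : ∀ k l, Integrable (fun g : (U2 × U2) × (U2 × U2) =>
      superOp t (localGate g.1) p k * superOp t U k l * superOp t (localGate g.2) l q)
      gadgetMeasure := fun k l =>
    Integrable.mul_prod (f := fun g => superOp t (localGate g) p k * superOp t U k l)
      (g := fun g => superOp t (localGate g) l q) ((hi p k).mul_const _) (hi l q)
  simp only [gadgetMoment, momentOp_apply, gadgetUnitary_eq, superOp_mul, mul_apply,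
    Finset.sum_mul]
  rw [integral_finsetSum _ fun l _ => integrable_finsetSum _ fun k _ => h2 k l]
  refine Finset.sum_congr rfl fun l _ => ?_
  rw [integral_finsetSum _ fun k _ => h2 k l]
  refine Finset.sum_congr rfl fun k _ => ?_
  rw [gadgetMeasure, integral_prod_mul
    (fun g => superOp t (localGate g) p k * superOp t U k l)
    (fun g => superOp t (localGate g) l q), integral_mul_const]
  rfl

/-! ### The twirl over a single qubit -/

theorem sum_fin_two_fun (f : (Fin 2 → Fin 2) → ℂ) :
    ∑ z, f z = f ![0, 0] + f ![0, 1] + f ![1, 0] + f ![1, 1] := by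
  rw [← (finTwoArrowEquiv (Fin 2)).symm.sum_comp, Fintype.sum_prod_type]
  simp [Fin.sum_univ_two, finTwoArrowEquiv, add_assoc]

theorem forall_fin_two_fun {p : (Fin 2 → Fin 2) → Prop} :
    (∀ x, p x) ↔ p ![0, 0] ∧ p ![0, 1] ∧ p ![1, 0] ∧ p ![1, 1] := by
  rw [← (finTwoArrowEquiv (Fin 2)).symm.forall_congr_right]
  simp [finTwoArrowEquiv, Prod.forall, Fin.forall_fin_two, and_assoc]

/-- The exchange of the two copies of a qubit. -/
def swapOp : Matrix (Fin 2 → Fin 2) (Fin 2 → Fin 2) ℂ :=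
  of fun x y => if x 0 = y 1 ∧ x 1 = y 0 then 1 else 0

/-- The projection onto the singlet of the two copies of a qubit. -/
def antisymProj : Matrix (Fin 2 → Fin 2) (Fin 2 → Fin 2) ℂ := (1 / 2 : ℂ) • (1 - swapOp)

/-- The projection onto the triplet of the two copies of a qubit. -/
def symProj : Matrix (Fin 2 → Fin 2) (Fin 2 → Fin 2) ℂ := (1 / 2 : ℂ) • (1 + swapOp)

theorem swapOp_transpose : swapOpᵀ = swapOp := by
  ext x y
  simp only [swapOp, transpose_apply, of_apply]
  congr 1
  exact propext ⟨fun h => ⟨h.2.symm, h.1.symm⟩, fun h => ⟨h.2.symm, h.1.symm⟩⟩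

theorem swapOp_mul_swapOp : swapOp * swapOp = 1 := by
  ext x y
  revert x y
  simp [forall_fin_two_fun, mul_apply, sum_fin_two_fun, swapOp, one_apply]

theorem trace_swapOp : swapOp.trace = 2 := by
  simp only [trace, diag_apply, sum_fin_two_fun, swapOp, of_apply]
  norm_num

theorem tensorPow_comm_swapOp (A : Matrix (Fin 2) (Fin 2) ℂ) :
    tensorPow 2 A * swapOp = swapOp * tensorPow 2 A := by
  ext x y
  revert x y
  simp [forall_fin_two_fun, mul_apply, sum_fin_two_fun, swapOp, tensorPow, Fin.prod_univ_two,
    mul_comm]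

/-- The commutant of `A ⊗ A`, `A ∈ U(2)`, is spanned by the identity and the swap. It is found by
testing with `diag (1, i)`, the Pauli matrix `X` and one rotation with rational entries. -/
theorem eq_smul_add_smul_of_commute (M : Matrix (Fin 2 → Fin 2) (Fin 2 → Fin 2) ℂ)
    (h : ∀ A : U2, tensorPow 2 (A : Matrix (Fin 2) (Fin 2) ℂ) * M = M * tensorPow 2 A.1) :
    ∃ a b : ℂ, M = a • antisymProj + b • symProj := by
  have hZ : !![1, 0; 0, Complex.I] ∈ unitaryGroup (Fin 2) ℂ := by
    rw [mem_unitaryGroup_iff]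
    ext i j; fin_cases i <;> fin_cases j <;>
      simp [star_eq_conjTranspose, mul_apply, Fin.sum_univ_two]
  have hX : !![0, 1; 1, 0] ∈ unitaryGroup (Fin 2) ℂ := by
    rw [mem_unitaryGroup_iff]
    ext i j; fin_cases i <;> fin_cases j <;>
      simp [star_eq_conjTranspose, mul_apply, Fin.sum_univ_two]
  have hR : !![3 / 5, 4 / 5; -(4 / 5), 3 / 5] ∈ unitaryGroup (Fin 2) ℂ := by
    rw [mem_unitaryGroup_iff]
    ext i j; fin_cases i <;> fin_cases j <;>
      simp [star_eq_conjTranspose, mul_apply, Fin.sum_univ_two, Complex.conj_ofNat] <;> norm_num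
  have eZ := fun x y => congrFun (congrFun (h ⟨_, hZ⟩) x) y
  have eX := fun x y => congrFun (congrFun (h ⟨_, hX⟩) x) y
  have eR := fun x => congrFun (congrFun (h ⟨_, hR⟩) x) ![0, 0]
  simp only [mul_apply, sum_fin_two_fun, tensorPow, of_apply, Fin.prod_univ_two] at eZ eX eR
  simp only [forall_fin_two_fun] at eZ eX eR
  simp at eZ eX eR
  obtain ⟨⟨z1, z2, z3⟩, ⟨z4, z5, z6, z7⟩, ⟨z8, z9, z10, z11⟩, z12, z13, z14⟩ := eZ
  obtain ⟨-, ⟨-, x1, x2, -⟩, -, x3, -⟩ := eX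
  obtain ⟨-, r, -⟩ := eR
  have h1 : (1 - Complex.I) ≠ 0 := fun h => by simpa using congrArg Complex.re h
  have h2 : (1 + Complex.I) ≠ 0 := fun h => by simpa using congrArg Complex.re h
  have k1 : ∀ {x : ℂ}, x * Complex.I = x → x = 0 := fun {x} hx =>
    mul_left_cancel₀ h1 (by linear_combination -hx)
  have k2 : ∀ {x : ℂ}, -x = x * Complex.I → x = 0 := fun {x} hx =>
    mul_left_cancel₀ h2 (by linear_combination -hx)
  have k3 : ∀ {x : ℂ}, x = -x → x = 0 := fun {x} hx => by linear_combination hx / 2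
  rw [mul_comm] at z4 z7 z8 z11
  have z1' := k1 z1.symm
  have z2' := k1 z2.symm
  have z3' := k3 z3
  have z4' := k1 z4
  have z7' := k2 z7.symm
  have z8' := k1 z8
  have z11' := k2 z11.symm
  have z12' := k3 z12.symm
  have z13' := k2 z13
  have z14' := k2 z14
  rw [z4', z7', z8', z12'] at r
  have r' : M ![0, 0] ![0, 0] = M ![0, 1] ![0, 1] + M ![0, 1] ![1, 0] := by
    linear_combination (-25 / 12 : ℂ) * r
  refine ⟨M ![0, 1] ![0, 1] - M ![0, 1] ![1, 0], M ![0, 0] ![0, 0], ?_⟩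
  have h11 : M ![1, 1] ![1, 1] = M ![0, 0] ![0, 0] := by tauto
  ext x y
  revert x y
  simp only [forall_fin_two_fun, antisymProj, symProj, Matrix.add_apply, Matrix.smul_apply,
    Matrix.sub_apply, swapOp, of_apply, one_apply, smul_eq_mul]
  simp [z1', z2', z3', z4', z7', z8', z11', z12', z13', z14', r', x1, x2, h11]
  refine ⟨by ring, ⟨by ring, by ring⟩, ⟨by ring, by ring⟩, by ring⟩

theorem antisymProj_mul_self : antisymProj * antisymProj = antisymProj := by
  simp only [antisymProj, smul_mul_smul_comm, sub_mul, mul_sub, swapOp_mul_swapOp, one_mul,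
    mul_one]
  module

theorem symProj_mul_self : symProj * symProj = symProj := by
  simp only [symProj, smul_mul_smul_comm, add_mul, mul_add, swapOp_mul_swapOp, one_mul, mul_one]
  module

theorem antisymProj_mul_symProj : antisymProj * symProj = 0 := by
  simp only [symProj, antisymProj, smul_mul_smul_comm, sub_mul, mul_add, swapOp_mul_swapOp,
    one_mul, mul_one]
  module

theorem symProj_mul_antisymProj : symProj * antisymProj = 0 := by
  simp only [symProj, antisymProj, smul_mul_smul_comm, mul_sub, add_mul, swapOp_mul_swapOp,
    one_mul, mul_one]
  module

theorem trace_antisymProj : antisymProj.trace = 1 := by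
  simp [antisymProj, trace_swapOp]; norm_num

theorem trace_symProj : symProj.trace = 3 := by
  simp [symProj, trace_swapOp]; norm_num

theorem antisymProj_transpose : antisymProjᵀ = antisymProj := by
  simp [antisymProj, swapOp_transpose]

theorem symProj_transpose : symProjᵀ = symProj := by
  simp [symProj, swapOp_transpose]

theorem momentOp_transpose {Ω ι : Type*} [MeasurableSpace Ω] (t : ℕ) (μ : Measure Ω)
    (V : Ω → Matrix ι ι ℂ) : (momentOp t μ V)ᵀ = momentOp t μ fun ω => (V ω)ᵀ := rfl

theorem continuous_U2_val : Continuous (fun A : U2 => (A : Matrix (Fin 2) (Fin 2) ℂ)) :=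
  continuous_subtype_val

theorem opVec_vecMul_twirl {P : Matrix (Fin 2 → Fin 2) (Fin 2 → Fin 2) ℂ}
    (hP : ∀ A, tensorPow 2 A * P = P * tensorPow 2 A) (q) :
    (opVec P ⬝ᵥ fun p => momentOp 2 haarU2 (fun A => A.1) p q) = opVec P q := by
  have h : (momentOp 2 haarU2 fun A => A.1)ᵀ *ᵥ opVec P = opVec P := by
    rw [momentOp_transpose]
    refine momentOp_mulVec_eq 2 haarU2 continuous_U2_val.matrix_transpose fun A => ?_
    rw [superOp_mulVec_opVec, tensorPow_conj_of_commute]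
    · exact Matrix.transpose_mem_unitaryGroup_iff.mpr A.2
    · exact hP _
  rw [dotProduct_comm]
  exact congrFun h q

/-- The moment operator of the Haar measure on `U(2)` is the orthogonal projection onto the span of
the singlet and the triplet projections. -/
theorem twirl_apply (p q) : momentOp 2 haarU2 (fun A => A.1) p q =
    opVec antisymProj p * opVec antisymProj q + opVec symProj p * opVec symProj q / 3 := by
  set M : Matrix (Fin 2 → Fin 2) (Fin 2 → Fin 2) ℂ :=
    of fun x y => momentOp 2 haarU2 (fun A => A.1) (x, y) q with hM
  have hMv : opVec M = fun p => momentOp 2 haarU2 (fun A => A.1) p q := rfl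
  obtain ⟨a, b, hab⟩ := eq_smul_add_smul_of_commute M fun A => by
    refine commute_of_superOp_mulVec 2 A.2 ?_
    have h := superOp_mul_momentOp 2 haarU2 continuous_U2_val A A.1 fun B => rfl
    ext p
    exact congrFun (congrFun h p) q
  have ca : ∀ A, tensorPow 2 A * antisymProj = antisymProj * tensorPow 2 A := fun A => by
    simp [antisymProj, mul_sub, sub_mul, tensorPow_comm_swapOp]
  have cb : ∀ A, tensorPow 2 A * symProj = symProj * tensorPow 2 A := fun A => by
    simp [symProj, mul_add, add_mul, tensorPow_comm_swapOp]
  have ha := opVec_vecMul_twirl ca q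
  have hb := opVec_vecMul_twirl cb q
  rw [← hMv, dotProduct_opVec, hab] at ha hb
  simp only [antisymProj_transpose, symProj_transpose, mul_add, Matrix.mul_smul, antisymProj_mul_self,
    symProj_mul_self, antisymProj_mul_symProj, symProj_mul_antisymProj, smul_zero, add_zero,
    zero_add, trace_smul, trace_antisymProj, trace_symProj, smul_eq_mul] at ha hb
  have := congrFun hMv p
  rw [← this, hab]
  simp only [opVec, Matrix.add_apply, Matrix.smul_apply, smul_eq_mul] at ha hb ⊢
  rw [← ha, ← hb]
  ring

/-! ### The local twirl over two qubits -/

/-- The operator on two copies of a qubit pair that acts as `P` on the copies of the first qubit and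
as `Q` on the copies of the second one. -/
def siteTensor (P Q : Matrix (Fin 2 → Fin 2) (Fin 2 → Fin 2) ℂ) :
    Matrix (Fin 2 → Fin 2 × Fin 2) (Fin 2 → Fin 2 × Fin 2) ℂ :=
  (P ⊗ₖ Q).submatrix (Equiv.arrowProdEquivProdArrow (Fin 2) (fun _ => Fin 2) (fun _ => Fin 2))
    (Equiv.arrowProdEquivProdArrow (Fin 2) (fun _ => Fin 2) (fun _ => Fin 2))

theorem siteTensor_apply (P Q x y) : siteTensor P Q x y =
    P (fun s => (x s).1) (fun s => (y s).1) * Q (fun s => (x s).2) (fun s => (y s).2) := rfl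

theorem siteTensor_mul (P Q P' Q') :
    siteTensor P Q * siteTensor P' Q' = siteTensor (P * P') (Q * Q') := by
  rw [siteTensor, siteTensor, submatrix_mul_equiv, ← mul_kronecker_mul, siteTensor]

theorem siteTensor_one : siteTensor 1 1 = 1 := by
  rw [siteTensor, one_kronecker_one, submatrix_one_equiv]

theorem siteTensor_transpose (P Q) : (siteTensor P Q)ᵀ = siteTensor Pᵀ Qᵀ := rfl

theorem trace_siteTensor (P Q) : (siteTensor P Q).trace = P.trace * Q.trace := by
  rw [← trace_kronecker, siteTensor, trace, trace]
  exact Equiv.sum_comp (Equiv.arrowProdEquivProdArrow (Fin 2) (fun _ => Fin 2) (fun _ => Fin 2))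
    fun i => (P ⊗ₖ Q) i i

theorem tensorPow_localGate (g : U2 × U2) :
    tensorPow 2 (localGate g) = siteTensor (tensorPow 2 g.1.1) (tensorPow 2 g.2.1) := by
  ext x y
  simp [tensorPow, siteTensor_apply, localGate, Finset.prod_mul_distrib]

/-- The local twirl is the tensor product of the twirls over the two qubits. -/
theorem localTwirl_apply (p q) : localTwirl 2 p q =
    momentOp 2 haarU2 (fun A => A.1) (fun s => (p.1 s).1, fun s => (p.2 s).1)
        (fun s => (q.1 s).1, fun s => (q.2 s).1) *
      momentOp 2 haarU2 (fun A => A.1) (fun s => (p.1 s).2, fun s => (p.2 s).2)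
        (fun s => (q.1 s).2, fun s => (q.2 s).2) := by
  rw [localTwirl, momentOp_apply, momentOp_apply, momentOp_apply, ← integral_prod_mul]
  congr 1
  ext g
  simp only [superOp_apply, localGate, kroneckerMap_apply, Finset.prod_mul_distrib, star_mul']
  ring

/-- The exchange of the two copies of a qubit pair. -/
def pairSwap : Matrix (Fin 2 → Fin 2 × Fin 2) (Fin 2 → Fin 2 × Fin 2) ℂ :=
  siteTensor swapOp swapOp

/-- The projection onto the antisymmetric subspace of two copies of a qubit pair. -/
def pairAnti : Matrix (Fin 2 → Fin 2 × Fin 2) (Fin 2 → Fin 2 × Fin 2) ℂ :=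
  (1 / 2 : ℂ) • (1 - pairSwap)

/-- The projection onto the symmetric subspace of two copies of a qubit pair. -/
def pairSym : Matrix (Fin 2 → Fin 2 × Fin 2) (Fin 2 → Fin 2 × Fin 2) ℂ :=
  (1 / 2 : ℂ) • (1 + pairSwap)

/-- The difference singlet ⊗ triplet - triplet ⊗ singlet: a reflection of the six-dimensional
antisymmetric subspace, which plays the role of a Hodge star on two-forms. -/
def chirality : Matrix (Fin 2 → Fin 2 × Fin 2) (Fin 2 → Fin 2 × Fin 2) ℂ :=
  (1 / 2 : ℂ) • (siteTensor 1 swapOp - siteTensor swapOp 1)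

/-- The projection onto the product of the two singlets. -/
def singletPair : Matrix (Fin 2 → Fin 2 × Fin 2) (Fin 2 → Fin 2 × Fin 2) ℂ :=
  siteTensor antisymProj antisymProj

/-- The part of the product of the singlet projections which is orthogonal to `pairSym`. -/
def singletTraceless : Matrix (Fin 2 → Fin 2 × Fin 2) (Fin 2 → Fin 2 × Fin 2) ℂ :=
  singletPair - (1 / 10 : ℂ) • pairSym

/-- The four mutually orthogonal operators that span the commutant of the local unitaries. -/
def localBasis : Fin 4 → Matrix (Fin 2 → Fin 2 × Fin 2) (Fin 2 → Fin 2 × Fin 2) ℂ :=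
  ![pairAnti, pairSym, chirality, singletTraceless]

/-- The inverse squared Hilbert-Schmidt norms of `localBasis`. -/
def localWeight : Fin 4 → ℂ := ![1 / 6, 1 / 10, 1 / 6, 10 / 9]

theorem localTwirl_eq : localTwirl 2 =
    ∑ k, localWeight k • vecMulVec (opVec (localBasis k)) (opVec (localBasis k)) := by
  ext p q
  rw [localTwirl_apply, twirl_apply, twirl_apply]
  simp only [Fin.sum_univ_four, localWeight, localBasis, cons_val, Matrix.add_apply,
    Matrix.smul_apply, vecMulVec_apply, opVec, pairAnti, pairSym, chirality, singletTraceless,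
    singletPair, pairSwap, Matrix.sub_apply, ← siteTensor_one, siteTensor_apply, smul_eq_mul,
    antisymProj, symProj]
  ring

theorem pairSwap_mul_pairSwap : pairSwap * pairSwap = 1 := by
  rw [pairSwap, siteTensor_mul, swapOp_mul_swapOp, siteTensor_one]

theorem trace_pairSwap : pairSwap.trace = 4 := by
  rw [pairSwap, trace_siteTensor, trace_swapOp]; norm_num

theorem pairSwap_apply (x y) : pairSwap x y = if x 0 = y 1 ∧ x 1 = y 0 then 1 else 0 := by
  simp only [pairSwap, siteTensor_apply, swapOp, of_apply, ← ite_and, mul_ite, mul_one, mul_zero,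
    Prod.ext_iff]
  congr 1
  exact propext (by tauto)

theorem tensorPow_comm_pairSwap (U : Gate) :
    tensorPow 2 U * pairSwap = pairSwap * tensorPow 2 U := by
  have h1 : ∀ x y, pairSwap x y = if x = ![y 1, y 0] then 1 else 0 := fun x y => by
    rw [pairSwap_apply]
    congr 1
    simp [funext_iff, Fin.forall_fin_two]
  have h2 : ∀ x y, pairSwap x y = if ![x 1, x 0] = y then 1 else 0 := fun x y => by
    rw [pairSwap_apply]
    congr 1
    simp [funext_iff, Fin.forall_fin_two, and_comm]
  ext x y
  rw [mul_apply, mul_apply]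
  simp_rw [fun z => h1 z y, h2 x]
  simp [tensorPow, Fin.prod_univ_two, mul_comm]

theorem localBasis_transpose (k) : (localBasis k)ᵀ = localBasis k := by
  fin_cases k <;>
  simp [localBasis, pairAnti, pairSym, chirality, singletTraceless, singletPair, pairSwap,
    siteTensor_transpose, swapOp_transpose, antisymProj_transpose]

theorem pairAnti_mul_self : pairAnti * pairAnti = pairAnti := by
  simp only [pairAnti, smul_mul_smul_comm, sub_mul, mul_sub, pairSwap_mul_pairSwap, one_mul,
    mul_one]
  module

theorem pairSym_mul_self : pairSym * pairSym = pairSym := by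
  simp only [pairSym, smul_mul_smul_comm, add_mul, mul_add, pairSwap_mul_pairSwap, one_mul, mul_one]
  module

theorem pairAnti_mul_pairSym : pairAnti * pairSym = 0 := by
  simp only [pairSym, pairAnti, smul_mul_smul_comm, sub_mul, mul_add, pairSwap_mul_pairSwap,
    one_mul, mul_one]
  module

theorem pairSym_mul_pairAnti : pairSym * pairAnti = 0 := by
  simp only [pairSym, pairAnti, smul_mul_smul_comm, mul_sub, add_mul, pairSwap_mul_pairSwap,
    one_mul, mul_one]
  module

theorem pairSwap_mul_chirality : pairSwap * chirality = - chirality := by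
  simp only [pairSwap, chirality, mul_smul_comm, mul_sub, siteTensor_mul, swapOp_mul_swapOp,
    mul_one]
  module

theorem chirality_mul_pairSwap : chirality * pairSwap = - chirality := by
  simp only [pairSwap, chirality, smul_mul_assoc, sub_mul, siteTensor_mul, swapOp_mul_swapOp,
    one_mul]
  module

theorem swapOp_mul_antisymProj : swapOp * antisymProj = - antisymProj := by
  simp only [antisymProj, mul_smul_comm, mul_sub, swapOp_mul_swapOp, mul_one]
  module

theorem pairSwap_mul_singletPair : pairSwap * singletPair = singletPair := by
  rw [pairSwap, singletPair, siteTensor_mul, swapOp_mul_antisymProj]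
  ext x y
  simp [siteTensor_apply]

theorem pairAnti_mul_chirality : pairAnti * chirality = chirality := by
  simp only [pairAnti, smul_mul_assoc, sub_mul, one_mul, pairSwap_mul_chirality]
  module

theorem chirality_mul_pairAnti : chirality * pairAnti = chirality := by
  simp only [pairAnti, mul_smul_comm, mul_sub, mul_one, chirality_mul_pairSwap]
  module

theorem pairSym_mul_chirality : pairSym * chirality = 0 := by
  simp only [pairSym, smul_mul_assoc, add_mul, one_mul, pairSwap_mul_chirality]
  module

theorem pairSym_mul_singletPair : pairSym * singletPair = singletPair := by
  simp only [pairSym, smul_mul_assoc, add_mul, one_mul, pairSwap_mul_singletPair]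
  module

theorem pairAnti_mul_singletTraceless : pairAnti * singletTraceless = 0 := by
  have h : pairAnti * singletPair = 0 := by
    simp only [pairAnti, smul_mul_assoc, sub_mul, one_mul, pairSwap_mul_singletPair]
    module
  simp [singletTraceless, mul_sub, h, pairAnti_mul_pairSym]

theorem pairSym_mul_singletTraceless : pairSym * singletTraceless = singletTraceless := by
  simp [singletTraceless, mul_sub, pairSym_mul_singletPair, pairSym_mul_self]

theorem trace_pairAnti : pairAnti.trace = 6 := by
  simp [pairAnti, trace_pairSwap]; norm_num

theorem trace_pairSym : pairSym.trace = 10 := by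
  simp [pairSym, trace_pairSwap]; norm_num

theorem trace_chirality : chirality.trace = 0 := by
  simp [chirality, trace_siteTensor, trace_swapOp, mul_comm]

theorem trace_singletPair : singletPair.trace = 1 := by
  simp [singletPair, trace_siteTensor, trace_antisymProj]

theorem trace_singletTraceless : singletTraceless.trace = 0 := by
  simp [singletTraceless, trace_singletPair, trace_pairSym]

theorem chirality_mul_self : chirality * chirality = pairAnti := by
  simp only [chirality, pairAnti, smul_mul_smul_comm, sub_mul, mul_sub, siteTensor_mul,
    swapOp_mul_swapOp, one_mul, mul_one, siteTensor_one, pairSwap]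
  module

theorem tensorPow_comm_pairAnti (U : Gate) :
    tensorPow 2 U * pairAnti = pairAnti * tensorPow 2 U := by
  simp [pairAnti, mul_sub, sub_mul, tensorPow_comm_pairSwap]

theorem tensorPow_comm_pairSym (U : Gate) :
    tensorPow 2 U * pairSym = pairSym * tensorPow 2 U := by
  simp [pairSym, mul_add, add_mul, tensorPow_comm_pairSwap]

/-! ### The second moment operator of a gadget -/

/-- The Hilbert-Schmidt pairing of `A` with the image of `B` under conjugation by `U ⊗ U`. -/
def conjPairing (U : Gate) (A B : Matrix (Fin 2 → Fin 2 × Fin 2) (Fin 2 → Fin 2 × Fin 2) ℂ) : ℂ :=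
  (A * tensorPow 2 U * B * (tensorPow 2 U)ᴴ).trace

theorem sandwich_sum_vecMulVec {κ : Type*} [Fintype κ] {n : ℕ} (c : Fin n → κ → ℂ) (r : Fin n → ℂ)
    (W : Matrix κ κ ℂ) (h : ∀ k l, k ≠ l → c k ⬝ᵥ W *ᵥ c l = 0) :
    (∑ k, r k • vecMulVec (c k) (c k)) * W * (∑ k, r k • vecMulVec (c k) (c k)) =
      ∑ k, (r k ^ 2 * (c k ⬝ᵥ W *ᵥ c k)) • vecMulVec (c k) (c k) := by
  have key : ∀ a b, vecMulVec a a * (W * vecMulVec b b) = (a ⬝ᵥ W *ᵥ b) • vecMulVec a b :=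
    fun a b => by rw [mul_vecMulVec, vecMulVec_mul_vecMulVec, vecMulVec_smul]
  rw [Matrix.mul_assoc, Matrix.sum_mul]
  refine Finset.sum_congr rfl fun k _ => ?_
  rw [Matrix.mul_sum, Matrix.mul_sum, Finset.sum_eq_single k]
  · rw [mul_smul_comm, mul_smul_comm, smul_mul_assoc, key, smul_smul, smul_smul]
    congr 1
    ring
  · intro l _ hl
    rw [mul_smul_comm, mul_smul_comm, smul_mul_assoc, key, h k l hl.symm]
    simp
  · simp

theorem dotProduct_superOp (U : Gate) (k) (B) :
    opVec (localBasis k) ⬝ᵥ superOp 2 U *ᵥ opVec B = conjPairing U (localBasis k) B := by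
  rw [superOp_mulVec_opVec, dotProduct_opVec, localBasis_transpose, conjPairing]
  simp only [Matrix.mul_assoc]

theorem conjPairing_of_comm_left {U : Gate} (hU : U ∈ unitaryGroup (Fin 2 × Fin 2) ℂ) {A}
    (hA : tensorPow 2 U * A = A * tensorPow 2 U) (B) : conjPairing U A B = (A * B).trace := by
  rw [conjPairing, ← hA, trace_mul_comm, Matrix.mul_assoc, ← Matrix.mul_assoc,
    tensorPow_conjTranspose_mul 2 hU, Matrix.one_mul]

theorem conjPairing_of_comm_right {U : Gate} (hU : U ∈ unitaryGroup (Fin 2 × Fin 2) ℂ) (A) {B}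
    (hB : tensorPow 2 U * B = B * tensorPow 2 U) : conjPairing U A B = (A * B).trace := by
  rw [conjPairing, Matrix.mul_assoc A, hB, Matrix.mul_assoc, Matrix.mul_assoc B,
    tensorPow_mul_conjTranspose 2 hU, Matrix.mul_one]

theorem conjPairing_chirality_singletTraceless {U : Gate} :
    conjPairing U chirality singletTraceless = 0 := by
  rw [conjPairing, ← chirality_mul_pairAnti, Matrix.mul_assoc chirality,
    ← tensorPow_comm_pairAnti, ← Matrix.mul_assoc, Matrix.mul_assoc _ pairAnti,
    pairAnti_mul_singletTraceless]
  simp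

theorem singletTraceless_mul_pairAnti : singletTraceless * pairAnti = 0 := by
  have h := congrArg transpose pairAnti_mul_singletTraceless
  rwa [transpose_mul, show pairAntiᵀ = pairAnti from localBasis_transpose 0,
    show singletTracelessᵀ = singletTraceless from localBasis_transpose 3, transpose_zero] at h

theorem conjPairing_singletTraceless_chirality {U : Gate} :
    conjPairing U singletTraceless chirality = 0 := by
  rw [conjPairing, ← pairAnti_mul_chirality, ← Matrix.mul_assoc, Matrix.mul_assoc singletTraceless,
    tensorPow_comm_pairAnti, ← Matrix.mul_assoc, singletTraceless_mul_pairAnti]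
  simp

theorem conjPairing_orthogonal {U : Gate} (hU : U ∈ unitaryGroup (Fin 2 × Fin 2) ℂ) (k l)
    (hkl : k ≠ l) : conjPairing U (localBasis k) (localBasis l) = 0 := by
  have hA := tensorPow_comm_pairAnti U
  have hS := tensorPow_comm_pairSym U
  have h01 := conjPairing_of_comm_left hU hA pairSym
  have h02 := conjPairing_of_comm_left hU hA chirality
  have h03 := conjPairing_of_comm_left hU hA singletTraceless
  have h10 := conjPairing_of_comm_left hU hS pairAnti
  have h12 := conjPairing_of_comm_left hU hS chirality
  have h13 := conjPairing_of_comm_left hU hS singletTraceless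
  have h20 := conjPairing_of_comm_right hU chirality hA
  have h21 := conjPairing_of_comm_right hU chirality hS
  have h30 := conjPairing_of_comm_right hU singletTraceless hA
  have h31 := conjPairing_of_comm_right hU singletTraceless hS
  rw [trace_mul_comm] at h20 h21 h30 h31
  simp only [pairAnti_mul_pairSym, pairAnti_mul_chirality, pairAnti_mul_singletTraceless,
    pairSym_mul_pairAnti, pairSym_mul_chirality, pairSym_mul_singletTraceless, trace_chirality,
    trace_singletTraceless, trace_zero] at h01 h02 h03 h10 h12 h13 h20 h21 h30 h31
  have h23 := conjPairing_chirality_singletTraceless (U := U)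
  have h32 := conjPairing_singletTraceless_chirality (U := U)
  fin_cases k <;> fin_cases l
  exacts [absurd rfl hkl, h01, h02, h03, h10, absurd rfl hkl, h12, h13, h20, h21, absurd rfl hkl,
    h23, h30, h31, h32, absurd rfl hkl]

theorem conjPairing_singletTraceless {U : Gate} (hU : U ∈ unitaryGroup (Fin 2 × Fin 2) ℂ) :
    conjPairing U singletTraceless singletTraceless =
      conjPairing U singletPair singletPair - 1 / 10 := by
  have h1 := conjPairing_of_comm_left hU (tensorPow_comm_pairSym U) singletPair
  have h2 := conjPairing_of_comm_right hU singletTraceless (tensorPow_comm_pairSym U)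
  rw [pairSym_mul_singletPair, trace_singletPair, conjPairing] at h1
  rw [trace_mul_comm, pairSym_mul_singletTraceless, trace_singletTraceless, conjPairing] at h2
  rw [conjPairing, conjPairing]
  nth_rewrite 2 [singletTraceless]
  rw [mul_sub, sub_mul, trace_sub, mul_smul_comm, smul_mul_assoc, trace_smul, h2, smul_zero,
    sub_zero, singletTraceless, sub_mul, sub_mul, sub_mul, trace_sub, smul_mul_assoc,
    smul_mul_assoc, smul_mul_assoc, trace_smul, h1, smul_eq_mul, mul_one]

/-- The second moment operator of a gadget is diagonal in the basis `localBasis`. -/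
theorem gadgetMoment_eq {U : Gate} (hU : U ∈ unitaryGroup (Fin 2 × Fin 2) ℂ) :
    gadgetMoment 2 U = (1 / 6 : ℂ) • vecMulVec (opVec pairAnti) (opVec pairAnti)
      + (1 / 10 : ℂ) • vecMulVec (opVec pairSym) (opVec pairSym)
      + (conjPairing U chirality chirality / 36) • vecMulVec (opVec chirality) (opVec chirality)
      + ((100 * conjPairing U singletPair singletPair - 10) / 81) •
        vecMulVec (opVec singletTraceless) (opVec singletTraceless) := by
  rw [gadgetMoment_eq_twirl, localTwirl_eq, sandwich_sum_vecMulVec]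
  · simp only [dotProduct_superOp]
    simp only [Fin.sum_univ_four, localWeight, localBasis, cons_val]
    rw [conjPairing_of_comm_left hU (tensorPow_comm_pairAnti U),
      conjPairing_of_comm_left hU (tensorPow_comm_pairSym U), conjPairing_singletTraceless hU,
      pairAnti_mul_self, pairSym_mul_self, trace_pairAnti, trace_pairSym]
    congr 1
    · congr 1
      · congr 1 <;> congr 1 <;> norm_num
      · congr 1; ring
    · congr 1; ring
  · intro k l hkl
    rw [dotProduct_superOp, conjPairing_orthogonal hU k l hkl]

/-! ### The Hodge star and the two local invariants -/

/-- The invariant symplectic form of a qubit. -/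
def eps : Matrix (Fin 2) (Fin 2) ℂ := !![0, 1; -1, 0]

/-- The symmetric bilinear form `eps ⊗ eps` on two qubits, preserved by local gates up to phase. -/
def spinFlip : Gate := eps ⊗ₖ eps

/-- The local invariant `E U E Uᵀ` of a two-qubit gate, where `E` is the spin flip. -/
def spinFlipInvariant (U : Gate) : Gate := spinFlip * U * spinFlip * Uᵀ

/-- The four-linear form on `ℂ⁴` obtained by lowering the indices of `chirality`. -/
def hodgeForm (a b c d : Fin 2 × Fin 2) : ℂ :=
  (eps a.1 c.1 * eps a.2 d.2 * eps b.1 d.1 * eps b.2 c.2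
    - eps a.1 d.1 * eps a.2 c.2 * eps b.1 c.1 * eps b.2 d.2) / 2

/-- The Hodge form is `-1/2` times the Levi-Civita symbol of the lexicographically ordered
computational basis. -/
theorem hodgeForm_sum_eq_det (p q r s : Fin 2 × Fin 2 → ℂ) :
    ∑ a, ∑ b, ∑ c, ∑ d, hodgeForm a b c d * (p a * q b * (r c * s d)) =
      -1 / 2 * (of fun i j : Fin 4 => ![p, q, r, s] j
        ((finProdFinEquiv (m := 2) (n := 2)).symm i)).det := by
  have e0 : (finProdFinEquiv (m := 2) (n := 2)).symm (0 : Fin 4) = (0, 0) := rfl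
  have e1 : (finProdFinEquiv (m := 2) (n := 2)).symm (1 : Fin 4) = (0, 1) := rfl
  have e2 : (finProdFinEquiv (m := 2) (n := 2)).symm (2 : Fin 4) = (1, 0) := rfl
  have e3 : (finProdFinEquiv (m := 2) (n := 2)).symm (3 : Fin 4) = (1, 1) := rfl
  have f1 : Fin.succAbove (1 : Fin 4) 0 = 0 := rfl
  have f2 : Fin.succAbove (1 : Fin 4) 1 = 2 := rfl
  have f3 : Fin.succAbove (1 : Fin 4) 2 = 3 := rfl
  have f4 : Fin.succAbove (2 : Fin 4) 0 = 0 := rfl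
  have f5 : Fin.succAbove (2 : Fin 4) 1 = 1 := rfl
  have f6 : Fin.succAbove (2 : Fin 4) 2 = 3 := rfl
  have f7 : Fin.succAbove (3 : Fin 4) 0 = 0 := rfl
  have f8 : Fin.succAbove (3 : Fin 4) 1 = 1 := rfl
  have f9 : Fin.succAbove (3 : Fin 4) 2 = 2 := rfl
  have g0 : Fin.succ (0 : Fin 3) = 1 := rfl
  have g1 : Fin.succ (1 : Fin 3) = 2 := rfl
  have g2 : Fin.succ (2 : Fin 3) = 3 := rfl
  rw [det_succ_row_zero]
  simp only [Fin.sum_univ_four, det_fin_three, submatrix_apply, of_apply, e0, e1, e2, e3,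
    f1, f2, f3, f4, f5, f6, f7, f8, f9, g0, g1, g2, Fin.zero_succAbove, cons_val]
  simp [Fintype.sum_prod_type, Fin.sum_univ_two, hodgeForm, eps]
  ring

theorem hodgeForm_sum_mul (U : Gate) (a' b' c' d') :
    ∑ a, ∑ b, ∑ c, ∑ d, hodgeForm a b c d * (U a a' * U b b' * (U c c' * U d d')) =
      U.det * hodgeForm a' b' c' d' := by
  set e := (finProdFinEquiv (m := 2) (n := 2)).symm
  have h : ∀ V : Gate, (of fun i j : Fin 4 => ![(V · a'), (V · b'), (V · c'), (V · d')] j (e i))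
      = V.submatrix e ![a', b', c', d'] := fun V => by
    ext i j
    fin_cases j <;> rfl
  have h1 := hodgeForm_sum_eq_det (U · a') (U · b') (U · c') (U · d')
  have h2 := hodgeForm_sum_eq_det ((1 : Gate) · a') ((1 : Gate) · b') ((1 : Gate) · c')
    ((1 : Gate) · d')
  rw [h] at h1 h2
  have h3 : U.submatrix e ![a', b', c', d'] =
      U.submatrix e e * (1 : Gate).submatrix e ![a', b', c', d'] := by
    rw [submatrix_mul_equiv, Matrix.mul_one]
  have h4 : ∑ a, ∑ b, ∑ c, ∑ d, hodgeForm a b c d *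
      ((1 : Gate) a a' * (1 : Gate) b b' * ((1 : Gate) c c' * (1 : Gate) d d')) =
      hodgeForm a' b' c' d' := by
    simp [one_apply]
  rw [h1, h3, det_mul, det_submatrix_equiv_self, ← h4, h2]
  ring

/-- The matrix of the Hodge form on pairs of two-qubit states. -/
def hodge : Matrix (Fin 2 → Fin 2 × Fin 2) (Fin 2 → Fin 2 × Fin 2) ℂ :=
  of fun x y => hodgeForm (x 0) (x 1) (y 0) (y 1)

theorem sum_fin_two_pair (f : (Fin 2 → Fin 2 × Fin 2) → ℂ) :
    ∑ z, f z = ∑ a, ∑ b, f ![a, b] := by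
  rw [← (finTwoArrowEquiv (Fin 2 × Fin 2)).symm.sum_comp, Fintype.sum_prod_type]
  simp [finTwoArrowEquiv]

/-- Gates act on the Hodge form through their determinant. -/
theorem tensorPow_transpose_mul_hodge (U : Gate) :
    (tensorPow 2 U)ᵀ * hodge * tensorPow 2 U = U.det • hodge := by
  ext x y
  simp only [mul_apply, Finset.sum_mul]
  rw [Finset.sum_comm]
  simp only [sum_fin_two_pair, transpose_apply, tensorPow, of_apply, Fin.prod_univ_two,
    hodge, Matrix.smul_apply, smul_eq_mul, cons_val, ← hodgeForm_sum_mul]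
  exact Finset.sum_congr rfl fun a _ => Finset.sum_congr rfl fun b _ => Finset.sum_congr rfl
    fun c _ => Finset.sum_congr rfl fun d _ => by ring

theorem siteTensor_one_swapOp_apply (x y) :
    siteTensor 1 swapOp x y = if x = ![((y 0).1, (y 1).2), ((y 1).1, (y 0).2)] then 1 else 0 := by
  simp only [siteTensor_apply, swapOp, of_apply, one_apply, ← ite_and, mul_ite, mul_one, mul_zero]
  congr 1
  simp [funext_iff, Fin.forall_fin_two, Prod.ext_iff]
  tauto

theorem siteTensor_swapOp_one_apply (x y) :
    siteTensor swapOp 1 x y = if x = ![((y 1).1, (y 0).2), ((y 0).1, (y 1).2)] then 1 else 0 := by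
  simp only [siteTensor_apply, swapOp, of_apply, one_apply, ← ite_and, mul_ite, mul_one, mul_zero]
  congr 1
  simp [funext_iff, Fin.forall_fin_two, Prod.ext_iff]
  tauto

theorem tensorPow_spinFlip_mul_chirality : tensorPow 2 spinFlip * chirality = hodge := by
  ext x y
  rw [chirality, mul_smul_comm, mul_sub, Matrix.smul_apply, Matrix.sub_apply, mul_apply, mul_apply]
  simp_rw [fun z => siteTensor_one_swapOp_apply z y, fun z => siteTensor_swapOp_one_apply z y]
  simp [tensorPow, Fin.prod_univ_two, hodge, hodgeForm, spinFlip]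
  ring

theorem eps_mul_eps : eps * eps = -1 := by
  ext i j; fin_cases i <;> fin_cases j <;> simp [eps, mul_apply, Fin.sum_univ_two]

theorem eps_transpose : epsᵀ = - eps := by
  ext i j; fin_cases i <;> fin_cases j <;> simp [eps]

theorem eps_map_star : eps.map star = eps := by
  ext i j; fin_cases i <;> fin_cases j <;> simp [eps]

theorem spinFlip_mul_self : spinFlip * spinFlip = 1 := by
  rw [spinFlip, ← mul_kronecker_mul, eps_mul_eps]
  ext i j
  simp only [kroneckerMap_apply, Matrix.neg_apply, neg_mul_neg]
  simp [one_apply, Prod.ext_iff, ← ite_and, and_comm]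

theorem spinFlip_transpose : spinFlipᵀ = spinFlip := by
  rw [spinFlip, ← kroneckerMap_transpose, eps_transpose]
  ext i j; simp

theorem spinFlip_map_star : spinFlip.map star = spinFlip := by
  ext i j
  have h := fun a b => congrFun (congrFun eps_map_star a) b
  simp only [map_apply] at h
  simp only [spinFlip, map_apply, kroneckerMap_apply, star_mul', h]

theorem spinFlip_mem : spinFlip ∈ unitaryGroup (Fin 2 × Fin 2) ℂ := by
  rw [mem_unitaryGroup_iff, star_eq_conjTranspose, conjTranspose, spinFlip_transpose,
    spinFlip_map_star, spinFlip_mul_self]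

theorem spinFlipInvariant_mem {U : Gate} (hU : U ∈ unitaryGroup (Fin 2 × Fin 2) ℂ) :
    spinFlipInvariant U ∈ unitaryGroup (Fin 2 × Fin 2) ℂ :=
  mul_mem (mul_mem (mul_mem spinFlip_mem hU) spinFlip_mem) (transpose_mem_unitaryGroup_iff.mpr hU)

theorem antisymProj_apply (x y) : antisymProj x y = eps (x 0) (x 1) * eps (y 0) (y 1) / 2 := by
  revert x y
  simp [forall_fin_two_fun, antisymProj, swapOp, eps, one_apply]
  norm_num

/-- `singletPair` has rank one, with range spanned by the spin flip as a vector, so that the pairing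
is the squared modulus of a matrix element of `U ⊗ U`. -/
theorem conjPairing_singletPair (U : Gate) :
    conjPairing U singletPair singletPair =
      (Complex.normSq (spinFlipInvariant U).trace / 16 : ℝ) := by
  set ψ : (Fin 2 → Fin 2 × Fin 2) → ℂ := fun x => spinFlip (x 0) (x 1) / 2 with hψ
  have h : singletPair = vecMulVec ψ ψ := by
    ext x y
    simp only [singletPair, siteTensor_apply, antisymProj_apply, vecMulVec_apply, hψ, spinFlip,
      kroneckerMap_apply]
    ring
  have hs : ∀ a b, star (spinFlip a b) = spinFlip a b := fun a b =>
    congrFun (congrFun spinFlip_map_star a) b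
  have hψs : star ψ = ψ := by
    ext x
    simp only [hψ, Pi.star_apply, star_div₀, hs]
    simp
  have hz : ψ ⬝ᵥ tensorPow 2 U *ᵥ ψ = (spinFlipInvariant U).trace / 4 := by
    have ht : ∀ a b, spinFlip a b = spinFlip b a := fun a b =>
      congrFun (congrFun spinFlip_transpose b) a
    simp only [spinFlipInvariant, Matrix.mul_assoc, dotProduct, mulVec, sum_fin_two_pair, hψ,
      tensorPow, of_apply, Fin.prod_univ_two, cons_val, trace, diag_apply, mul_apply,
      transpose_apply, Finset.mul_sum, Finset.sum_div]
    refine Finset.sum_congr rfl fun a _ => Finset.sum_congr rfl fun b _ => ?_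
    rw [Finset.sum_comm]
    refine Finset.sum_congr rfl fun c _ => Finset.sum_congr rfl fun d _ => ?_
    rw [ht d c]
    ring
  have hz' : ψ ⬝ᵥ (tensorPow 2 U)ᴴ *ᵥ ψ = star ((spinFlipInvariant U).trace / 4) := by
    rw [← hz, ← star_dotProduct_star, star_mulVec, hψs, ← dotProduct_mulVec]
  rw [conjPairing, h, Matrix.mul_assoc (vecMulVec ψ ψ), mul_vecMulVec, vecMulVec_mul_vecMulVec,
    hz, Matrix.vecMulVec_mul, trace_vecMulVec, smul_vecMul, dotProduct_smul, dotProduct_comm ψ,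
    ← dotProduct_mulVec, hz', smul_eq_mul, Complex.star_def, Complex.mul_conj]
  simp
  norm_num

theorem chirality_conjTranspose : chiralityᴴ = chirality := by
  ext x y
  have h : ∀ x y, star (swapOp x y) = swapOp x y := fun x y => by simp [swapOp, apply_ite]
  have h1 : ∀ x y, star ((1 : Matrix (Fin 2 → Fin 2) (Fin 2 → Fin 2) ℂ) x y) =
    (1 : Matrix (Fin 2 → Fin 2) (Fin 2 → Fin 2) ℂ) x y := fun x y => by simp [one_apply, apply_ite]
  have ht := congrFun (congrFun (localBasis_transpose 2) x) y
  simp only [localBasis, cons_val, transpose_apply] at ht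
  rw [conjTranspose_apply, ← ht]
  simp [chirality, siteTensor_apply, h, h1]

theorem conjPairing_chirality_star (U : Gate) :
    star (conjPairing U chirality chirality) = conjPairing U chirality chirality := by
  rw [conjPairing, ← trace_conjTranspose]
  simp only [conjTranspose_mul, conjTranspose_conjTranspose, chirality_conjTranspose]
  rw [← Matrix.mul_assoc, ← Matrix.mul_assoc, trace_mul_comm]
  simp only [Matrix.mul_assoc]

/-- The real number `tr (δ (U ⊗ U) δ (U ⊗ U)†)`, where `δ` is the chirality. -/
def chiralInvariant (U : Gate) : ℝ := (conjPairing U chirality chirality).re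

/-- The real number `|tr (E U E Uᵀ)|²`, where `E` is the spin flip. -/
def singletInvariant (U : Gate) : ℝ := Complex.normSq (spinFlipInvariant U).trace

theorem conjPairing_chirality (U : Gate) :
    conjPairing U chirality chirality = (chiralInvariant U : ℂ) :=
  (Complex.conj_eq_iff_re.mp (conjPairing_chirality_star U)).symm

theorem trace_tensorPow_mul_pairAnti (N : Gate) :
    (tensorPow 2 N * pairAnti).trace = (N.trace ^ 2 - (N * N).trace) / 2 := by
  have h1 : (tensorPow 2 N).trace = N.trace ^ 2 := by
    simp [trace, sum_fin_two_pair, tensorPow, Fin.prod_univ_two, sq, Finset.sum_mul_sum]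
  have h2 : (tensorPow 2 N * pairSwap).trace = (N * N).trace := by
    have h1 : ∀ x y, pairSwap x y = if x = ![y 1, y 0] then 1 else 0 := fun x y => by
      rw [pairSwap_apply]
      congr 1
      simp [funext_iff, Fin.forall_fin_two]
    simp only [trace, diag_apply, mul_apply (M := tensorPow 2 N)]
    simp_rw [fun z y => h1 z y]
    simp [sum_fin_two_pair, tensorPow, Fin.prod_univ_two, mul_apply]
  rw [pairAnti, mul_smul_comm, mul_sub, Matrix.mul_one, trace_smul, trace_sub, h1, h2, smul_eq_mul]
  ring

/-- The chiral invariant in terms of the spin-flip invariant: `δ` is the Hodge star with lowered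
indices, so that `δ (U ⊗ U) δ` is, up to the factor `det U`, the spin flip of `conj U ⊗ conj U`. -/
theorem chiralInvariant_eq {U : Gate} (hU : U ∈ unitaryGroup (Fin 2 × Fin 2) ℂ) :
    (chiralInvariant U : ℂ) = U.det * star ((spinFlipInvariant U).trace ^ 2 -
      (spinFlipInvariant U * spinFlipInvariant U).trace) / 2 := by
  have hE : tensorPow 2 spinFlip * tensorPow 2 spinFlip = 1 := by
    rw [← tensorPow_mul, spinFlip_mul_self, tensorPow_one]
  have hδ : chirality = tensorPow 2 spinFlip * hodge := by
    rw [← tensorPow_spinFlip_mul_chirality, ← Matrix.mul_assoc, hE, Matrix.one_mul]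
  have hH : hodge * tensorPow 2 U = U.det • (tensorPow 2 (U.map star) * hodge) := by
    rw [← mul_smul_comm, ← tensorPow_transpose_mul_hodge, Matrix.mul_assoc (tensorPow 2 U)ᵀ,
      ← Matrix.mul_assoc, ← tensorPow_transpose, ← tensorPow_mul]
    have : U.map star * Uᵀ = 1 := by
      have := congrArg (fun M => M.map star) (mem_unitaryGroup_iff.mp hU)
      ext i j
      have := congrFun (congrFun this i) j
      simpa [mul_apply, star_eq_conjTranspose, one_apply, apply_ite] using this
    rw [this, tensorPow_one, Matrix.one_mul]
  set N : Gate := spinFlip * U.map star * spinFlip * Uᴴ with hN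
  have hNm : N = (spinFlipInvariant U).map star := by
    have hm : ∀ A B : Gate, (A * B).map star = A.map star * B.map star := fun A B => by
      ext i j; simp [mul_apply]
    rw [spinFlipInvariant, hm, hm, hm, spinFlip_map_star]
    rfl
  have hmt : ∀ A : Gate, (A.map star).trace = star A.trace := fun A => by simp [trace]
  have hmm : ∀ A B : Gate, A.map star * B.map star = (A * B).map star := fun A B => by
    ext i j; simp [mul_apply]
  rw [← conjPairing_chirality, conjPairing]
  nth_rewrite 1 [hδ]
  rw [Matrix.mul_assoc (tensorPow 2 spinFlip), hH, mul_smul_comm, smul_mul_assoc, smul_mul_assoc,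
    trace_smul, smul_eq_mul, mul_div_assoc]
  congr 1
  rw [← tensorPow_spinFlip_mul_chirality]
  have : tensorPow 2 spinFlip * (tensorPow 2 (U.map star) * (tensorPow 2 spinFlip * chirality)) *
      chirality * (tensorPow 2 U)ᴴ = tensorPow 2 N * pairAnti := by
    rw [hN, tensorPow_mul, tensorPow_mul, tensorPow_mul, Matrix.mul_assoc _ _ pairAnti,
      tensorPow_comm_pairAnti, ← chirality_mul_self, tensorPow_conjTranspose]
    simp only [Matrix.mul_assoc]
  rw [this, trace_tensorPow_mul_pairAnti, hNm, hmm, hmt, hmt, star_sub, star_pow]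

/-- If the singlet invariant vanishes, then the chiral invariant is at least its value at the
`iSWAP` gate. -/
theorem neg_two_le_chiralInvariant {U : Gate} (hU : U ∈ unitaryGroup (Fin 2 × Fin 2) ℂ)
    (h : singletInvariant U = 0) : -2 ≤ chiralInvariant U := by
  have h0 : (spinFlipInvariant U).trace = 0 := Complex.normSq_eq_zero.mp h
  have h1 := chiralInvariant_eq hU
  have hm := mul_mem (spinFlipInvariant_mem hU) (spinFlipInvariant_mem hU)
  set m := spinFlipInvariant U * spinFlipInvariant U
  have h2 : ‖m.trace‖ ≤ 4 := by
    refine (norm_sum_le _ _).trans ?_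
    refine (Finset.sum_le_sum fun i _ => entry_norm_bound_of_unitary hm i i).trans ?_
    simp
  have h3 : ‖U.det‖ = 1 := by
    have := det_of_mem_unitary hU
    simpa using CStarRing.norm_of_mem_unitary this
  have h4 : |chiralInvariant U| ≤ 2 := by
    rw [← Real.norm_eq_abs, ← Complex.norm_real, h1, h0, norm_div, norm_mul, h3, norm_star]
    simp
    linarith
  exact (abs_le.mp h4).1

/-! ### The invariants in terms of KAK coefficients -/

/-- The unnormalized Bell basis: `(c, d)` labels the column `|0, d⟩ + (-1)^c |1, 1 + d⟩`. -/
def bell : Gate := of fun x y =>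
  if x.1 + x.2 = y.2 then (if x.1 = 1 ∧ y.1 = 1 then -1 else 1) else 0

/-- The two-qubit operator with eigenvalues `d` in the Bell basis. -/
def bellDiag (d : Fin 2 × Fin 2 → ℂ) : Gate := (1 / 2 : ℂ) • (bell * diagonal d * bellᵀ)

theorem bell_transpose_mul : bellᵀ * bell = (2 : ℂ) • 1 := by
  ext ⟨i, j⟩ ⟨k, l⟩
  fin_cases i <;> fin_cases j <;> fin_cases k <;> fin_cases l <;>
    simp [mul_apply, Fintype.sum_prod_type, Fin.sum_univ_two, bell] <;> norm_num

theorem bell_mul_transpose : bell * bellᵀ = (2 : ℂ) • 1 := by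
  ext ⟨i, j⟩ ⟨k, l⟩
  fin_cases i <;> fin_cases j <;> fin_cases k <;> fin_cases l <;>
    simp [mul_apply, Fintype.sum_prod_type, Fin.sum_univ_two, bell] <;> norm_num

theorem bellDiag_mul (d e : Fin 2 × Fin 2 → ℂ) :
    bellDiag d * bellDiag e = bellDiag fun i => d i * e i := by
  have : bell * diagonal d * bellᵀ * (bell * diagonal e * bellᵀ) =
      bell * diagonal d * (bellᵀ * bell) * diagonal e * bellᵀ := by
    simp only [Matrix.mul_assoc]
  rw [bellDiag, bellDiag, smul_mul_smul_comm, this, bell_transpose_mul, bellDiag,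
    ← diagonal_mul_diagonal]
  simp only [mul_smul_comm, smul_mul_assoc, smul_smul, Matrix.mul_one, Matrix.mul_assoc]
  congr 1
  norm_num

theorem bellDiag_one : bellDiag (fun _ => 1) = 1 := by
  rw [bellDiag, diagonal_one, Matrix.mul_one, bell_mul_transpose, smul_smul]
  norm_num

theorem bellDiag_transpose (d) : (bellDiag d)ᵀ = bellDiag d := by
  simp [bellDiag, transpose_mul, Matrix.mul_assoc]

theorem bellDiag_conjTranspose (d) : (bellDiag d)ᴴ = bellDiag (star d) := by
  have h : bellᴴ = bellᵀ := by
    ext i j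
    simp only [bell, conjTranspose_apply, transpose_apply, of_apply]
    split_ifs <;> simp
  have h' : bellᵀᴴ = bell := by rw [← h, conjTranspose_conjTranspose]
  simp [bellDiag, conjTranspose_mul, Matrix.mul_assoc, h, h', diagonal_conjTranspose]

theorem trace_bellDiag (d) : (bellDiag d).trace = ∑ i, d i := by
  rw [bellDiag, trace_smul, Matrix.mul_assoc, trace_mul_comm, Matrix.mul_assoc, bell_transpose_mul,
    mul_smul_comm, Matrix.mul_one, trace_smul, trace_diagonal, smul_smul]
  norm_num

theorem bell_inv : bell⁻¹ = (1 / 2 : ℂ) • bellᵀ := by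
  refine inv_eq_right_inv ?_
  rw [mul_smul_comm, bell_mul_transpose, smul_smul]
  norm_num

theorem isUnit_bell : IsUnit bell := by
  refine IsUnit.of_mul_eq_one ((1 / 2 : ℂ) • bellᵀ) ?_
  rw [mul_smul_comm, bell_mul_transpose, smul_smul]
  norm_num

theorem bellDiag_eq_conj (d) : bellDiag d = bell * diagonal d * bell⁻¹ := by
  rw [bell_inv, mul_smul_comm, bellDiag]

theorem det_bellDiag (d) : (bellDiag d).det = ∏ i, d i := by
  rw [bellDiag_eq_conj, det_conj isUnit_bell, det_diagonal]

theorem bellDiag_mem {d : Fin 2 × Fin 2 → ℂ} (h : ∀ i, d i * star (d i) = 1) :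
    bellDiag d ∈ unitaryGroup (Fin 2 × Fin 2) ℂ := by
  rw [mem_unitaryGroup_iff, star_eq_conjTranspose, bellDiag_conjTranspose, bellDiag_mul,
    ← bellDiag_one]
  congr 1
  exact funext h

/-- The spin flip is diagonal in the Bell basis. -/
theorem spinFlip_eq_bellDiag :
    spinFlip = bellDiag fun x => if x = (0, 0) ∨ x = (1, 1) then 1 else -1 := by
  ext ⟨i, j⟩ ⟨k, l⟩
  fin_cases i <;> fin_cases j <;> fin_cases k <;> fin_cases l <;>
    simp [bellDiag, mul_apply, Fintype.sum_prod_type, Fin.sum_univ_two, bell, spinFlip, eps,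
      diagonal_apply] <;> norm_num

theorem spinFlipInvariant_bellDiag (d) :
    spinFlipInvariant (bellDiag d) = bellDiag fun i => d i ^ 2 := by
  rw [spinFlipInvariant, bellDiag_transpose, spinFlip_eq_bellDiag, bellDiag_mul, bellDiag_mul,
    bellDiag_mul]
  congr 1
  ext i
  split_ifs <;> ring

/-- The eigenvalues of the Hamiltonian of `kakGate kx ky kz` in the Bell basis. -/
def kakPhase (kx ky kz : ℝ) (x : Fin 2 × Fin 2) : ℝ :=
  if x = (0, 0) then kx - ky + kz else if x = (1, 0) then -kx + ky + kz else
    if x = (0, 1) then kx + ky - kz else -kx - ky - kz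

theorem kakGate_eq (kx ky kz : ℝ) :
    kakGate kx ky kz = bellDiag fun x => Complex.exp (Complex.I * kakPhase kx ky kz x) := by
  have h : Complex.I • ((kx : ℂ) • (pauliX ⊗ₖ pauliX) + (ky : ℂ) • (pauliY ⊗ₖ pauliY)
      + (kz : ℂ) • (pauliZ ⊗ₖ pauliZ)) = bellDiag fun x => Complex.I * kakPhase kx ky kz x := by
    ext ⟨i, j⟩ ⟨k, l⟩
    fin_cases i <;> fin_cases j <;> fin_cases k <;> fin_cases l <;>
      simp [bellDiag, mul_apply, Fintype.sum_prod_type, Fin.sum_univ_two, bell, kakPhase,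
        diagonal_apply, pauliX, pauliY, pauliZ] <;> ring
  rw [kakGate, h, bellDiag_eq_conj, Matrix.exp_conj _ _ isUnit_bell, Matrix.exp_diagonal,
    ← bellDiag_eq_conj]
  congr 1
  ext x
  rw [Pi.coe_exp]
  simp [Complex.exp_eq_exp_ℂ]

theorem kakGate_mem (kx ky kz : ℝ) : kakGate kx ky kz ∈ unitaryGroup (Fin 2 × Fin 2) ℂ := by
  rw [kakGate_eq]
  refine bellDiag_mem fun i => ?_
  rw [Complex.star_def, ← Complex.exp_conj, ← Complex.exp_add]
  simp

theorem cos_four_mul (k : ℝ) : ((Real.cos (4 * k) : ℝ) : ℂ) =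
    (Complex.exp (Complex.I * k) ^ 4 + (Complex.exp (Complex.I * k))⁻¹ ^ 4) / 2 := by
  rw [← Complex.exp_neg, ← Complex.exp_nat_mul, ← Complex.exp_nat_mul, Complex.ofReal_cos,
    Complex.cos]
  congr 3 <;> push_cast <;> ring

theorem exp_kakPhase (kx ky kz : ℝ) (x) : Complex.exp (Complex.I * kakPhase kx ky kz x) =
    if x = (0, 0) then Complex.exp (Complex.I * kx) * (Complex.exp (Complex.I * ky))⁻¹ *
      Complex.exp (Complex.I * kz) else
    if x = (1, 0) then (Complex.exp (Complex.I * kx))⁻¹ * Complex.exp (Complex.I * ky) *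
      Complex.exp (Complex.I * kz) else
    if x = (0, 1) then Complex.exp (Complex.I * kx) * Complex.exp (Complex.I * ky) *
      (Complex.exp (Complex.I * kz))⁻¹ else
    (Complex.exp (Complex.I * kx))⁻¹ * (Complex.exp (Complex.I * ky))⁻¹ *
      (Complex.exp (Complex.I * kz))⁻¹ := by
  simp only [← Complex.exp_neg, ← Complex.exp_add, kakPhase]
  split_ifs <;> congr 1 <;> push_cast <;> ring

theorem star_exp_I_mul (k : ℝ) :
    star (Complex.exp (Complex.I * k)) = (Complex.exp (Complex.I * k))⁻¹ := by
  rw [Complex.star_def, ← Complex.exp_conj, ← Complex.exp_neg]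
  simp

theorem chiralInvariant_kakGate (kx ky kz : ℝ) : chiralInvariant (kakGate kx ky kz) =
    2 * (Real.cos (4 * kx) + Real.cos (4 * ky) + Real.cos (4 * kz)) := by
  have h := chiralInvariant_eq (kakGate_mem kx ky kz)
  rw [← Complex.ofReal_inj, h, kakGate_eq, spinFlipInvariant_bellDiag, bellDiag_mul, trace_bellDiag,
    trace_bellDiag, det_bellDiag]
  simp only [exp_kakPhase, Fintype.sum_prod_type, Fintype.prod_prod_type, Fin.sum_univ_two,
    Fin.prod_univ_two, Prod.mk.injEq, zero_ne_one, one_ne_zero, and_true, and_false, if_true, if_false,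
    Complex.ofReal_mul, Complex.ofReal_add, cos_four_mul, Complex.ofReal_ofNat]
  have hx := star_exp_I_mul kx
  have hy := star_exp_I_mul ky
  have hz := star_exp_I_mul kz
  have hx0 := Complex.exp_ne_zero (Complex.I * kx)
  have hy0 := Complex.exp_ne_zero (Complex.I * ky)
  have hz0 := Complex.exp_ne_zero (Complex.I * kz)
  generalize Complex.exp (Complex.I * kx) = x at *
  generalize Complex.exp (Complex.I * ky) = y at *
  generalize Complex.exp (Complex.I * kz) = z at *
  simp only [star_sub, star_add, star_mul', star_pow, star_inv₀, hx, hy, hz, inv_inv]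
  field_simp
  ring

theorem singletInvariant_kakGate (kx ky kz : ℝ) : singletInvariant (kakGate kx ky kz) =
    4 + 4 * (Real.cos (4 * kx) * Real.cos (4 * ky) + Real.cos (4 * kx) * Real.cos (4 * kz)
      + Real.cos (4 * ky) * Real.cos (4 * kz)) := by
  rw [← Complex.ofReal_inj, singletInvariant, ← Complex.mul_conj, ← Complex.star_def, kakGate_eq,
    spinFlipInvariant_bellDiag, trace_bellDiag]
  simp only [exp_kakPhase, Fintype.sum_prod_type, Fin.sum_univ_two,
    Prod.mk.injEq, zero_ne_one, one_ne_zero, and_true, and_false, if_true, if_false,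
    Complex.ofReal_mul, Complex.ofReal_add, cos_four_mul, Complex.ofReal_ofNat]
  have hx := star_exp_I_mul kx
  have hy := star_exp_I_mul ky
  have hz := star_exp_I_mul kz
  have hx0 := Complex.exp_ne_zero (Complex.I * kx)
  have hy0 := Complex.exp_ne_zero (Complex.I * ky)
  have hz0 := Complex.exp_ne_zero (Complex.I * kz)
  generalize Complex.exp (Complex.I * kx) = x at *
  generalize Complex.exp (Complex.I * ky) = y at *
  generalize Complex.exp (Complex.I * kz) = z at *
  simp only [star_add, star_mul', star_pow, star_inv₀, hx, hy, hz, inv_inv]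
  field_simp
  ring

theorem singletInvariant_iSWAP : singletInvariant iSWAP = 0 := by
  rw [iSWAP, singletInvariant_kakGate]
  rw [show 4 * (Real.pi / 4) = Real.pi by ring]
  simp

theorem chiralInvariant_iSWAP : chiralInvariant iSWAP = -2 := by
  rw [iSWAP, chiralInvariant_kakGate]
  rw [show 4 * (Real.pi / 4) = Real.pi by ring]
  simp

theorem iSWAP_mem : iSWAP ∈ unitaryGroup (Fin 2 × Fin 2) ℂ := kakGate_mem _ _ _

theorem tensorPow_localGate_comm_chirality (g : U2 × U2) :
    tensorPow 2 (localGate g) * chirality = chirality * tensorPow 2 (localGate g) := by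
  simp only [tensorPow_localGate, chirality, mul_smul_comm, smul_mul_assoc, mul_sub, sub_mul,
    siteTensor_mul, tensorPow_comm_swapOp, Matrix.mul_one, Matrix.one_mul]

theorem conjPairing_local {A B}
    (hA : ∀ g, tensorPow 2 (localGate g) * A = A * tensorPow 2 (localGate g))
    (hB : ∀ g, tensorPow 2 (localGate g) * B = B * tensorPow 2 (localGate g)) (U : Gate) (g h) :
    conjPairing (localGate g * U * localGate h) A B = conjPairing U A B := by
  have h1 := tensorPow_conj_of_commute 2 (localGate_mem h) (hB h)
  have h2 := tensorPow_conjTranspose_mul 2 (localGate_mem g)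
  rw [conjPairing, conjPairing, tensorPow_mul, tensorPow_mul, conjTranspose_mul, conjTranspose_mul]
  calc _ = (A * tensorPow 2 (localGate g) * (tensorPow 2 U * (tensorPow 2 (localGate h) * B *
        (tensorPow 2 (localGate h))ᴴ) * (tensorPow 2 U)ᴴ * (tensorPow 2 (localGate g))ᴴ)).trace := by
        simp only [Matrix.mul_assoc]
    _ = _ := by
      rw [h1, ← hA, Matrix.mul_assoc, trace_mul_comm, ← Matrix.mul_assoc A, Matrix.mul_assoc _ _
        (tensorPow 2 (localGate g)), h2, Matrix.mul_one]
      simp only [Matrix.mul_assoc]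

theorem HasKAK.chiralInvariant_eq {U : Gate} {kx ky kz : ℝ} (h : HasKAK U kx ky kz) :
    chiralInvariant U = 2 * (Real.cos (4 * kx) + Real.cos (4 * ky) + Real.cos (4 * kz)) := by
  obtain ⟨A₁, A₂, B₁, B₂, rfl⟩ := h
  rw [← chiralInvariant_kakGate]
  exact congrArg Complex.re (conjPairing_local tensorPow_localGate_comm_chirality
    tensorPow_localGate_comm_chirality _ (A₁, A₂) (B₁, B₂))

/-! ### The semidefinite order on two-qubit moment operators -/

open scoped ComplexOrder

theorem gadgetMoment_eq_invariants {U : Gate} (hU : U ∈ unitaryGroup (Fin 2 × Fin 2) ℂ) :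
    gadgetMoment 2 U = (1 / 6 : ℂ) • vecMulVec (opVec pairAnti) (opVec pairAnti)
      + (1 / 10 : ℂ) • vecMulVec (opVec pairSym) (opVec pairSym)
      + ((chiralInvariant U / 36 : ℝ) : ℂ) • vecMulVec (opVec chirality) (opVec chirality)
      + ((25 / 324 * singletInvariant U - 10 / 81 : ℝ) : ℂ) •
        vecMulVec (opVec singletTraceless) (opVec singletTraceless) := by
  rw [gadgetMoment_eq hU, conjPairing_chirality, conjPairing_singletPair]
  congr 1
  · congr 1
    congr 1
    push_cast
    ring
  · congr 1
    rw [singletInvariant]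
    push_cast
    ring

theorem star_opVec_localBasis (k) : star (opVec (localBasis k)) = opVec (localBasis k) := by
  have h : ∀ x y, star (swapOp x y) = swapOp x y := fun x y => by simp [swapOp, apply_ite]
  have h1 : ∀ x y, star ((1 : Matrix (Fin 2 → Fin 2) (Fin 2 → Fin 2) ℂ) x y) =
    (1 : Matrix (Fin 2 → Fin 2) (Fin 2 → Fin 2) ℂ) x y := fun x y => by simp [one_apply, apply_ite]
  ext p
  fin_cases k <;>
  simp only [opVec, localBasis, Pi.star_apply, pairAnti, pairSym, chirality, singletTraceless,
    singletPair, pairSwap, ← siteTensor_one, Matrix.sub_apply, Matrix.add_apply, Matrix.smul_apply,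
    siteTensor_apply, antisymProj, smul_eq_mul, star_mul', star_add, star_sub, star_div₀, star_one,
    h, h1, star_ofNat, cons_val, Fin.zero_eta, Fin.mk_one, Fin.reduceFinMk]

theorem star_opVec_chirality : star (opVec chirality) = opVec chirality :=
  star_opVec_localBasis 2

theorem star_opVec_singletTraceless : star (opVec singletTraceless) = opVec singletTraceless :=
  star_opVec_localBasis 3

theorem opVec_dotProduct_localBasis (k B) :
    opVec (localBasis k) ⬝ᵥ opVec B = (localBasis k * B).trace := by
  rw [dotProduct_opVec, localBasis_transpose]

theorem chirality_dotProduct_self : opVec chirality ⬝ᵥ opVec chirality = 6 := by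
  rw [show chirality = localBasis 2 from rfl, opVec_dotProduct_localBasis]
  exact (congrArg trace chirality_mul_self).trans trace_pairAnti

theorem chirality_dotProduct_singletTraceless :
    opVec chirality ⬝ᵥ opVec singletTraceless = 0 := by
  rw [show chirality = localBasis 2 from rfl, opVec_dotProduct_localBasis]
  change (chirality * singletTraceless).trace = 0
  rw [← chirality_mul_pairAnti, Matrix.mul_assoc, pairAnti_mul_singletTraceless]
  simp

theorem singletPair_mul_self : singletPair * singletPair = singletPair := by
  rw [singletPair, siteTensor_mul, antisymProj_mul_self]

theorem singletTraceless_dotProduct_self :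
    opVec singletTraceless ⬝ᵥ opVec singletTraceless = 9 / 10 := by
  rw [show opVec singletTraceless = opVec (localBasis 3) from rfl, opVec_dotProduct_localBasis]
  change (singletTraceless * singletTraceless).trace = 9 / 10
  nth_rewrite 1 [singletTraceless]
  rw [sub_mul, smul_mul_assoc, pairSym_mul_singletTraceless, singletTraceless, mul_sub,
    mul_smul_comm, singletPair_mul_self]
  rw [show singletPair * pairSym = singletPair by
    have h := congrArg transpose pairSym_mul_singletPair
    rwa [transpose_mul, show pairSymᵀ = pairSym from localBasis_transpose 1,
      show singletPairᵀ = singletPair by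
        simp [singletPair, siteTensor_transpose, antisymProj_transpose]] at h]
  simp only [trace_sub, trace_smul, trace_singletPair, trace_pairSym, smul_eq_mul]
  norm_num

theorem posSemidef_smul_vecMulVec_self {κ : Type*} [Fintype κ] {a : κ → ℂ} (ha : star a = a)
    {r : ℝ} (hr : 0 ≤ r) : ((r : ℂ) • vecMulVec a a).PosSemidef := by
  have h := posSemidef_vecMulVec_self_star a
  rw [ha] at h
  exact h.smul (by exact_mod_cast hr)

/-- Two-qubit second moment operators are compared by comparing the two invariants. -/
theorem gadgetMoment_le_iff {U V : Gate} (hU : U ∈ unitaryGroup (Fin 2 × Fin 2) ℂ)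
    (hV : V ∈ unitaryGroup (Fin 2 × Fin 2) ℂ) : gadgetMoment 2 U ≤ gadgetMoment 2 V ↔
      chiralInvariant U ≤ chiralInvariant V ∧ singletInvariant U ≤ singletInvariant V := by
  have hd : gadgetMoment 2 V - gadgetMoment 2 U =
      (((chiralInvariant V - chiralInvariant U) / 36 : ℝ) : ℂ) •
        vecMulVec (opVec chirality) (opVec chirality) +
      ((25 / 324 * (singletInvariant V - singletInvariant U) : ℝ) : ℂ) •
        vecMulVec (opVec singletTraceless) (opVec singletTraceless) := by
    rw [gadgetMoment_eq_invariants hU, gadgetMoment_eq_invariants hV]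
    push_cast
    module
  rw [Matrix.le_iff, hd]
  constructor
  · intro h
    have h1 := h.dotProduct_mulVec_nonneg (opVec chirality)
    have h2 := h.dotProduct_mulVec_nonneg (opVec singletTraceless)
    rw [star_opVec_chirality] at h1
    rw [star_opVec_singletTraceless] at h2
    simp only [add_mulVec, smul_mulVec, vecMulVec_mulVec, dotProduct_add, dotProduct_smul,
      chirality_dotProduct_self, chirality_dotProduct_singletTraceless,
      dotProduct_comm (opVec singletTraceless) (opVec chirality),
      singletTraceless_dotProduct_self] at h1 h2
    have h1' : (0 : ℂ) ≤ ((chiralInvariant V - chiralInvariant U : ℝ) : ℂ) := by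
      convert h1 using 1
      simp only [smul_eq_mul, op_smul_eq_mul, Complex.ofReal_div, Complex.ofReal_ofNat]
      ring
    have h2' : (0 : ℂ) ≤ (((singletInvariant V - singletInvariant U) / 16 : ℝ) : ℂ) := by
      convert h2 using 1
      push_cast [smul_eq_mul, op_smul_eq_mul]
      ring
    rw [Complex.zero_le_real] at h1' h2'
    constructor <;> linarith
  · rintro ⟨h1, h2⟩
    have h1' : 0 ≤ (chiralInvariant V - chiralInvariant U) / 36 := by linarith
    have h2' : 0 ≤ 25 / 324 * (singletInvariant V - singletInvariant U) := by linarith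
    exact (posSemidef_smul_vecMulVec_self star_opVec_chirality h1').add
      (posSemidef_smul_vecMulVec_self star_opVec_singletTraceless h2')

theorem gadgetMoment_isHermitian {U : Gate} (hU : U ∈ unitaryGroup (Fin 2 × Fin 2) ℂ) :
    (gadgetMoment 2 U).IsHermitian := by
  have h : ∀ k, (vecMulVec (opVec (localBasis k)) (opVec (localBasis k))).IsHermitian := fun k => by
    rw [IsHermitian, conjTranspose_vecMulVec, star_opVec_localBasis]
  have hr : ∀ r : ℝ, IsSelfAdjoint (r : ℂ) := fun r => Complex.conj_ofReal r
  have h6 : IsSelfAdjoint (1 / 6 : ℂ) := by simp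
  have h10 : IsSelfAdjoint (1 / 10 : ℂ) := by simp
  rw [gadgetMoment_eq_invariants hU]
  exact ((((h 0).smul h6).add ((h 1).smul h10)).add ((h 2).smul (hr _))).add ((h 3).smul (hr _))

/-- The least eigenvalue of the second moment operator of `iSWAP` is at least `-1/3`. -/
theorem gadgetMoment_iSWAP_add_posSemidef :
    (gadgetMoment 2 iSWAP + (1 / 3 : ℂ) • 1).PosSemidef := by
  set D := vecMulVec (opVec chirality) (opVec chirality) with hD
  set R := vecMulVec (opVec singletTraceless) (opVec singletTraceless) with hR
  -- The projection onto the span of the two eigenvectors with negative eigenvalues.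
  set P := (1 / 6 : ℂ) • D + (10 / 9 : ℂ) • R with hP
  have hPP : P * P = P := by
    rw [hP, hD, hR]
    simp only [add_mul, mul_add, smul_mul_smul_comm, vecMulVec_mul_vecMulVec,
      chirality_dotProduct_self, chirality_dotProduct_singletTraceless,
      dotProduct_comm (opVec singletTraceless) (opVec chirality),
      singletTraceless_dotProduct_self, vecMulVec_smul, smul_smul, zero_smul, vecMulVec_zero,
      smul_zero, add_zero, zero_add]
    congr 1 <;> congr 1 <;> norm_num
  have hPh : Pᴴ = P := by
    rw [hP, hD, hR]
    simp [conjTranspose_vecMulVec, star_opVec_chirality, star_opVec_singletTraceless]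
  have h1 : (1 - P).PosSemidef := by
    have h := posSemidef_conjTranspose_mul_self (1 - P)
    rw [conjTranspose_sub, conjTranspose_one, hPh] at h
    simpa [mul_sub, sub_mul, hPP] using h
  have hF : gadgetMoment 2 iSWAP + (1 / 3 : ℂ) • 1 =
      ((1 / 6 : ℝ) : ℂ) • vecMulVec (opVec pairAnti) (opVec pairAnti)
      + ((1 / 10 : ℝ) : ℂ) • vecMulVec (opVec pairSym) (opVec pairSym)
      + ((20 / 81 : ℝ) : ℂ) • R + (1 / 3 : ℂ) • (1 - P) := by
    rw [gadgetMoment_eq_invariants iSWAP_mem, chiralInvariant_iSWAP, singletInvariant_iSWAP, hP]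
    push_cast
    module
  rw [hF]
  refine (((posSemidef_smul_vecMulVec_self (star_opVec_localBasis 0) (by norm_num)).add
    (posSemidef_smul_vecMulVec_self (star_opVec_localBasis 1) (by norm_num))).add
    (posSemidef_smul_vecMulVec_self (star_opVec_localBasis 3) (by norm_num))).add (h1.smul ?_)
  rw [show (1 / 3 : ℂ) = ((1 / 3 : ℝ) : ℂ) by norm_num]
  exact_mod_cast (by norm_num : (0 : ℝ) ≤ 1 / 3)

/-! ### Gates on a register -/

section Register

variable {n : ℕ} {i j : Fin n}

/-- The sites other than `i` and `j`. -/
abbrev RestSite {n : ℕ} (i j : Fin n) : Type := {k : Fin n // k ≠ i ∧ k ≠ j}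

/-- Separating the bits at the sites `i` and `j` from the others. -/
def splitSites (hij : i ≠ j) : (Fin n → Fin 2) ≃ (Fin 2 × Fin 2) × (RestSite i j → Fin 2) where
  toFun x := ((x i, x j), fun k => x k)
  invFun p k := if hi : k = i then p.1.1 else if hj : k = j then p.1.2 else p.2 ⟨k, hi, hj⟩
  left_inv x := by
    ext k
    by_cases hi : k = i
    · simp [hi]
    · by_cases hj : k = j
      · simp [hj, hij.symm]
      · simp [hi, hj]
  right_inv p := by
    ext k
    · simp
    · simp [hij.symm]
    · simp [k.2.1, k.2.2]

theorem onSites_eq_submatrix (hij : i ≠ j) (V : Gate) :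
    onSites i j V = (V ⊗ₖ (1 : Matrix (RestSite i j → Fin 2) (RestSite i j → Fin 2) ℂ)).submatrix
      (splitSites hij) (splitSites hij) := by
  ext x y
  simp [onSites, splitSites, one_apply, funext_iff]

theorem onSites_mul (hij : i ≠ j) (V W : Gate) :
    onSites i j (V * W) = onSites i j V * onSites i j W := by
  rw [onSites_eq_submatrix hij, onSites_eq_submatrix hij, onSites_eq_submatrix hij,
    submatrix_mul_equiv, ← mul_kronecker_mul, Matrix.one_mul]

theorem onSites_mem (hij : i ≠ j) {V : Gate} (hV : V ∈ unitaryGroup (Fin 2 × Fin 2) ℂ) :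
    onSites i j V ∈ unitaryGroup (Fin n → Fin 2) ℂ := by
  have h := mem_unitaryGroup_iff.mp (kronecker_mem_unitary hV
    (one_mem (unitaryGroup (RestSite i j → Fin 2) ℂ)))
  rw [mem_unitaryGroup_iff, onSites_eq_submatrix hij, star_eq_conjTranspose,
    conjTranspose_submatrix, submatrix_mul_equiv, ← star_eq_conjTranspose, h, submatrix_one_equiv]

theorem continuous_onSites {Ω : Type*} [TopologicalSpace Ω] {V : Ω → Gate} (hV : Continuous V) :
    Continuous fun ω => onSites i j (V ω) := by
  refine continuous_matrix fun x y => ?_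
  simp only [onSites, of_apply]
  split_ifs
  · exact hV.matrix_elem _ _
  · exact continuous_const

/-- Separating the sites `i` and `j` from the others in all copies of a register. -/
def splitCopies (t : ℕ) (i j : Fin n) (p : (Fin t → Fin n → Fin 2) × (Fin t → Fin n → Fin 2)) :
    ((Fin t → Fin 2 × Fin 2) × (Fin t → Fin 2 × Fin 2)) ×
      ((Fin t → RestSite i j → Fin 2) × (Fin t → RestSite i j → Fin 2)) :=
  ((fun s => (p.1 s i, p.1 s j), fun s => (p.2 s i, p.2 s j)),
    (fun s k => p.1 s k, fun s k => p.2 s k))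

theorem splitCopies_injective (t : ℕ) : Function.Injective (splitCopies t i j) := by
  intro p q h
  simp only [splitCopies, Prod.mk.injEq, funext_iff, Subtype.forall] at h
  obtain ⟨⟨h1, h2⟩, h3, h4⟩ := h
  ext s k
  · by_cases hi : k = i
    · rw [hi, (h1 s).1]
    · by_cases hj : k = j
      · rw [hj, (h1 s).2]
      · rw [h3 s k ⟨hi, hj⟩]
  · by_cases hi : k = i
    · rw [hi, (h2 s).1]
    · by_cases hj : k = j
      · rw [hj, (h2 s).2]
      · rw [h4 s k ⟨hi, hj⟩]

theorem tensorPow_onSites (t : ℕ) (V : Gate) (x y : Fin t → Fin n → Fin 2) :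
    tensorPow t (onSites i j V) x y =
      tensorPow t V (fun s => (x s i, x s j)) (fun s => (y s i, y s j)) *
      (1 : Matrix (Fin t → RestSite i j → Fin 2) (Fin t → RestSite i j → Fin 2) ℂ)
        (fun s k => x s k) (fun s k => y s k) := by
  rw [← tensorPow_one]
  simp only [tensorPow, of_apply, ← Finset.prod_mul_distrib]
  refine Finset.prod_congr rfl fun s _ => ?_
  simp [onSites, one_apply, funext_iff]

/-- The moment operator of a random gate on two sites of a register is that of the gate, tensored
with the identity. -/
theorem momentOp_onSites {Ω : Type*} [MeasurableSpace Ω] (t : ℕ) (μ : Measure Ω) (V : Ω → Gate) :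
    momentOp t μ (fun ω => onSites i j (V ω)) =
      (momentOp t μ V ⊗ₖ (1 : Matrix
        ((Fin t → RestSite i j → Fin 2) × (Fin t → RestSite i j → Fin 2))
        ((Fin t → RestSite i j → Fin 2) × (Fin t → RestSite i j → Fin 2)) ℂ)).submatrix
        (splitCopies t i j) (splitCopies t i j) := by
  ext p q
  simp only [submatrix_apply, kroneckerMap_apply, momentOp_apply, ← integral_mul_const]
  congr 1
  ext ω
  rw [← one_kronecker_one]
  simp only [superOp, kroneckerMap_apply, map_apply, tensorPow_onSites, splitCopies, star_mul']
  rw [show ∀ x y, star ((1 : Matrix (Fin t → RestSite i j → Fin 2) (Fin t → RestSite i j → Fin 2) ℂ)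
    x y) = (1 : Matrix _ _ ℂ) x y from fun x y => by simp [one_apply, apply_ite]]
  ring

/-- The second moment operator of the gadget on the sites `i` and `j`. -/
def edgeMoment (U : Gate) (i j : Fin n) :=
  momentOp 2 gadgetMeasure fun g => onSites i j (gadgetUnitary U g)

theorem edgeMoment_eq (U : Gate) : edgeMoment U i j = (gadgetMoment 2 U ⊗ₖ 1).submatrix
    (splitCopies 2 i j) (splitCopies 2 i j) :=
  momentOp_onSites 2 gadgetMeasure (gadgetUnitary U)

theorem edgeMoment_isHermitian {U : Gate} (hU : U ∈ unitaryGroup (Fin 2 × Fin 2) ℂ) :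
    (edgeMoment U i j).IsHermitian := by
  rw [edgeMoment_eq]
  refine IsHermitian.submatrix ?_ _
  rw [IsHermitian, conjTranspose_kronecker, gadgetMoment_isHermitian hU, conjTranspose_one]

theorem edgeMoment_sub_posSemidef {U V : Gate} (h : gadgetMoment 2 V ≤ gadgetMoment 2 U) :
    (edgeMoment U i j - edgeMoment V i j).PosSemidef := by
  have e : edgeMoment U i j - edgeMoment V i j =
      ((gadgetMoment 2 U - gadgetMoment 2 V) ⊗ₖ 1).submatrix (splitCopies 2 i j)
        (splitCopies 2 i j) := by
    rw [edgeMoment_eq, edgeMoment_eq]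
    ext p q
    simp only [Matrix.sub_apply, submatrix_apply, kroneckerMap_apply]
    ring
  rw [e]
  exact ((Matrix.le_iff.mp h).kronecker PosSemidef.one).submatrix (splitCopies 2 i j)

theorem edgeMoment_iSWAP_add_posSemidef :
    (edgeMoment iSWAP i j + (1 / 3 : ℂ) • 1).PosSemidef := by
  have e : edgeMoment iSWAP i j + (1 / 3 : ℂ) • 1 =
      ((gadgetMoment 2 iSWAP + (1 / 3 : ℂ) • 1) ⊗ₖ 1).submatrix (splitCopies 2 i j)
        (splitCopies 2 i j) := by
    rw [edgeMoment_eq, ← submatrix_one _ (splitCopies_injective (i := i) (j := j) 2)]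
    ext p q
    simp only [Matrix.add_apply, Matrix.smul_apply, submatrix_apply, kroneckerMap_apply,
      smul_eq_mul, one_apply, Prod.ext_iff (x := splitCopies 2 i j p)]
    split_ifs <;> first | ring1 | (exfalso; tauto)
  rw [e]
  exact (gadgetMoment_iSWAP_add_posSemidef.kronecker PosSemidef.one).submatrix (splitCopies 2 i j)

theorem edgeMoment_mulVec_of_commute (hij : i ≠ j) {U : Gate}
    (hU : U ∈ unitaryGroup (Fin 2 × Fin 2) ℂ)
    {M : Matrix (Fin 2 → Fin n → Fin 2) (Fin 2 → Fin n → Fin 2) ℂ}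
    (hM : ∀ V ∈ unitaryGroup (Fin 2 × Fin 2) ℂ,
      tensorPow 2 (onSites i j V) * M = M * tensorPow 2 (onSites i j V)) :
    edgeMoment U i j *ᵥ opVec M = opVec M := by
  refine momentOp_mulVec_eq 2 gadgetMeasure (continuous_onSites (continuous_gadgetUnitary U))
    fun g => ?_
  have hg := gadgetUnitary_mem hU g
  rw [superOp_mulVec_opVec, tensorPow_conj_of_commute 2 (onSites_mem hij hg) (hM _ hg)]

/-! ### A single-site eigenvector -/

/-- Flipping the bit at the site `s` of the first copy. -/
def flipBit (s : Fin n) (x : Fin 2 → Fin n → Fin 2) : Fin 2 → Fin n → Fin 2 :=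
  Function.update x 0 (Function.update (x 0) s (1 - x 0 s))

/-- The Pauli matrix `X` at the site `s` of the first copy. -/
def flipOp (s : Fin n) : Matrix (Fin 2 → Fin n → Fin 2) (Fin 2 → Fin n → Fin 2) ℂ :=
  of fun x y => if x = flipBit s y then 1 else 0

theorem flipBit_flipBit (s : Fin n) (x) : flipBit s (flipBit s x) = x := by
  simp [flipBit]

/-- The sign of a computational basis state under the Pauli matrix `Z` at the site `s`. -/
def signBit (a : Fin 2) : ℂ := if a = 0 then 1 else -1

/-- The Pauli matrix `Z` at the site `s` of a register. -/
def phaseAt (s : Fin n) : Matrix (Fin n → Fin 2) (Fin n → Fin 2) ℂ :=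
  diagonal fun x => signBit (x s)

theorem signBit_one_sub (a : Fin 2) : signBit (1 - a) = - signBit a := by
  fin_cases a <;> simp [signBit]

theorem signBit_mul_self (a : Fin 2) : signBit a * signBit a = 1 := by
  fin_cases a <;> simp [signBit]

theorem star_signBit (a : Fin 2) : star (signBit a) = signBit a := by
  fin_cases a <;> simp [signBit]

theorem phaseAt_mem (s : Fin n) : phaseAt s ∈ unitaryGroup (Fin n → Fin 2) ℂ := by
  rw [mem_unitaryGroup_iff, star_eq_conjTranspose, phaseAt, diagonal_conjTranspose,
    diagonal_mul_diagonal, ← diagonal_one]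
  congr 1
  ext x
  simp only [Pi.star_apply, star_signBit, signBit_mul_self]

theorem tensorPow_phaseAt (s : Fin n) : tensorPow 2 (phaseAt s) =
    diagonal fun x => signBit (x 0 s) * signBit (x 1 s) := by
  ext x y
  by_cases h : x = y
  · subst h; simp [tensorPow, phaseAt, Fin.prod_univ_two]
  · obtain ⟨k, hk⟩ := Function.ne_iff.mp h
    rw [diagonal_apply_ne _ h, tensorPow, of_apply]
    exact Finset.prod_eq_zero (Finset.mem_univ k) (diagonal_apply_ne _ hk)

theorem flipOp_mul_phaseAt (s : Fin n) : flipOp s * tensorPow 2 (phaseAt s) =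
    - (tensorPow 2 (phaseAt s) * flipOp s) := by
  ext x y
  rw [tensorPow_phaseAt, Matrix.neg_apply, mul_diagonal, diagonal_mul, flipOp, of_apply]
  split_ifs with h
  · subst h
    simp [flipBit, signBit_one_sub]
  · simp

theorem superOp_phaseAt_mulVec (s : Fin n) :
    superOp 2 (phaseAt s) *ᵥ opVec (flipOp s) = - opVec (flipOp s) := by
  have h : tensorPow 2 (phaseAt s) * flipOp s * (tensorPow 2 (phaseAt s))ᴴ = - flipOp s := by
    rw [← neg_eq_iff_eq_neg, ← Matrix.neg_mul, ← flipOp_mul_phaseAt, Matrix.mul_assoc,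
      tensorPow_mul_conjTranspose 2 (phaseAt_mem s), Matrix.mul_one]
  rw [superOp_mulVec_opVec, h]
  rfl

theorem flipOp_orthogonal_commutant (s : Fin n) {M} (hM : M ∈ commutant 2 (Fin n → Fin 2)) :
    ∑ p, star (M p.1 p.2) * opVec (flipOp s) p = 0 := by
  have hc := hM _ (phaseAt_mem s)
  refine Finset.sum_eq_zero fun p _ => ?_
  simp only [opVec, flipOp, of_apply]
  split_ifs with h
  · have h' := congrFun (congrFun hc p.1) p.2
    rw [tensorPow_phaseAt, mul_diagonal, diagonal_mul, h] at h'
    simp only [flipBit, Function.update_self, signBit_one_sub, ne_eq, one_ne_zero,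
      not_false_eq_true, Function.update_of_ne] at h'
    have h1 := signBit_mul_self (p.2 0 s)
    have h2 := signBit_mul_self (p.2 1 s)
    have h0 : M p.1 p.2 = 0 := by
      rw [h]
      simp only [flipBit]
      linear_combination (-(signBit (p.2 0 s) * signBit (p.2 1 s)) / 2) * h' +
        (-M (Function.update p.2 0 (Function.update (p.2 0) s (1 - p.2 0 s))) p.2) *
          (signBit (p.2 1 s) * signBit (p.2 1 s) * h1 + h2)
    rw [h0]; simp
  · simp

theorem opVec_flipOp_ne_zero (s : Fin n) : opVec (flipOp s) ≠ 0 := by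
  intro h
  have := congrFun h (flipBit s 0, 0)
  simp [opVec, flipOp] at this

theorem tensorPow_onSites_comm_flipOp {s : Fin n} (hi : s ≠ i) (hj : s ≠ j) (V : Gate) :
    tensorPow 2 (onSites i j V) * flipOp s = flipOp s * tensorPow 2 (onSites i j V) := by
  have h1 : ∀ x y, flipOp s x y = if flipBit s x = y then 1 else 0 := fun x y => by
    rw [flipOp, of_apply]
    congr 1
    refine propext ⟨fun h => ?_, fun h => ?_⟩
    · rw [h, flipBit_flipBit]
    · rw [← h, flipBit_flipBit]
  ext x y
  rw [mul_apply, mul_apply]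
  simp_rw [h1 x]
  simp only [flipOp, of_apply, mul_ite, mul_one, mul_zero, ite_mul, one_mul, zero_mul,
    Finset.sum_ite_eq, Finset.sum_ite_eq', Finset.mem_univ, if_true]
  have e : ∀ a b : Fin 2, a = 1 - b ↔ 1 - a = b := by decide
  simp only [tensorPow, of_apply, Fin.prod_univ_two, onSites, flipBit, Function.update_self,
    Function.update_of_ne hi.symm, Function.update_of_ne hj.symm, ne_eq, one_ne_zero,
    not_false_eq_true, Function.update_of_ne]
  congr 2
  refine propext (forall_congr' fun k => ?_)
  by_cases hk : k = s
  · subst hk; simp [e]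
  · simp [hk]

theorem edgeMoment_mulVec_flipOp_of_ne (hij : i ≠ j) {U : Gate}
    (hU : U ∈ unitaryGroup (Fin 2 × Fin 2) ℂ) {s : Fin n} (hi : s ≠ i) (hj : s ≠ j) :
    edgeMoment U i j *ᵥ opVec (flipOp s) = opVec (flipOp s) :=
  edgeMoment_mulVec_of_commute hij hU fun V _ => tensorPow_onSites_comm_flipOp hi hj V

/-- The Pauli matrix `Z` as an element of `U(2)`. -/
def phaseU2 : U2 := ⟨diagonal signBit, by
  rw [mem_unitaryGroup_iff, star_eq_conjTranspose, diagonal_conjTranspose,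
    diagonal_mul_diagonal, ← diagonal_one]
  congr 1
  ext x
  simp only [Pi.star_apply, star_signBit, signBit_mul_self]⟩

theorem gadgetUnitary_mul (U : Gate) (a : U2 × U2) (g) :
    gadgetUnitary U ((a, 1) * g) = localGate a * gadgetUnitary U g := by
  simp only [gadgetUnitary_eq, Prod.fst_mul, Prod.snd_mul, one_mul, localGate_mul, Matrix.mul_assoc]

theorem onSites_localGate_phase (hij : i ≠ j) {s : Fin n} (hs : s = i ∨ s = j) :
    ∃ a : U2 × U2, onSites i j (localGate a) = phaseAt s := by
  have key : ∀ d : Fin 2 × Fin 2 → ℂ, (∀ x : Fin n → Fin 2, d (x i, x j) = signBit (x s)) →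
      onSites i j (diagonal d) = phaseAt s := by
    intro d hd
    rw [onSites_eq_submatrix hij, ← diagonal_one, diagonal_kronecker_diagonal,
      submatrix_diagonal_equiv, phaseAt]
    congr 1
    ext x
    simp [splitSites, hd]
  rcases hs with rfl | rfl
  · refine ⟨(phaseU2, 1), ?_⟩
    rw [localGate, phaseU2]
    simp only [OneMemClass.coe_one]
    rw [← diagonal_one, diagonal_kronecker_diagonal]
    exact key _ fun x => by simp
  · refine ⟨(1, phaseU2), ?_⟩
    rw [localGate, phaseU2]
    simp only [OneMemClass.coe_one]
    rw [← diagonal_one, diagonal_kronecker_diagonal]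
    exact key _ fun x => by simp

/-- On an edge at `s` the moment operator absorbs the Pauli matrix `Z` at `s`, which changes the
sign of `X`. -/
theorem edgeMoment_mulVec_flipOp_of_mem (hij : i ≠ j) {U : Gate}
    (hU : U ∈ unitaryGroup (Fin 2 × Fin 2) ℂ) {s : Fin n} (hs : s = i ∨ s = j) :
    edgeMoment U i j *ᵥ opVec (flipOp s) = 0 := by
  obtain ⟨a, ha⟩ := onSites_localGate_phase hij hs
  have h1 : superOp 2 (phaseAt s) * edgeMoment U i j = edgeMoment U i j :=
    superOp_mul_momentOp 2 gadgetMeasure (continuous_onSites (continuous_gadgetUnitary U)) (a, 1)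
      (phaseAt s) fun g => by rw [gadgetUnitary_mul, onSites_mul hij, ha]
  have h2 : (superOp 2 (phaseAt s))ᴴ = superOp 2 (phaseAt s) := by
    rw [superOp, conjTranspose_kronecker, tensorPow_phaseAt, diagonal_conjTranspose]
    congr 1
    · congr 1
      ext x
      simp only [Pi.star_apply, star_mul', star_signBit]
    · ext x y
      by_cases h : x = y
      · subst h
        simp only [conjTranspose_apply, map_apply, diagonal_apply_eq, star_mul', star_signBit]
      · simp [h, Ne.symm h]
  have h3 : edgeMoment U i j * superOp 2 (phaseAt s) = edgeMoment U i j := by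
    have h := congrArg conjTranspose h1
    rwa [conjTranspose_mul, h2, edgeMoment_isHermitian hU] at h
  have h4 : edgeMoment U i j *ᵥ opVec (flipOp s) = - (edgeMoment U i j *ᵥ opVec (flipOp s)) := by
    conv_lhs => rw [← h3, ← mulVec_mulVec, superOp_phaseAt_mulVec, mulVec_neg]
  exact self_eq_neg.mp h4

end Register

/-! ### Monotonicity of the largest eigenvalue off the commutant -/

/-- A symmetric operator has an eigenvalue above each of its Rayleigh quotients. -/
theorem exists_eigenvalue_ge_rayleigh {E : Type*} [NormedAddCommGroup E] [InnerProductSpace ℂ E]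
    [FiniteDimensional ℂ E] {g : E →ₗ[ℂ] E} (hg : g.IsSymmetric) {w : E} (hw : w ≠ 0) {r : ℝ}
    (hr : r * ‖w‖ ^ 2 ≤ RCLike.re (inner ℂ (g w) w)) :
    ∃ r' : ℝ, r ≤ r' ∧ ∃ v : E, v ≠ 0 ∧ g v = (r' : ℂ) • v := by
  have : Nontrivial E := ⟨w, 0, hw⟩
  obtain ⟨v, hv⟩ := hg.hasEigenvalue_iSup_of_finiteDimensional.exists_hasEigenvector
  refine ⟨_, ?_, v, hv.2, hv.apply_eq_smul⟩
  obtain ⟨B, hB⟩ := (LinearMap.toContinuousLinearMap g).bddAbove_rayleighQuotient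
  have hbdd : BddAbove (Set.range fun x : { x : E // x ≠ 0 } =>
      RCLike.re (inner ℂ (g x) (x : E)) / ‖(x : E)‖ ^ 2) := by
    refine ⟨B, ?_⟩
    rintro _ ⟨x, rfl⟩
    exact (le_abs_self _).trans (hB ⟨x.1, rfl⟩)
  refine le_trans ?_ (le_ciSup hbdd ⟨w, hw⟩)
  have hn : 0 < ‖w‖ ^ 2 := by positivity
  rwa [le_div_iff₀ hn]

/-- If `T ≤ S` and `S` fixes every vector of `C`, then every eigenvalue of `T` with an eigenvector
orthogonal to `C` is at most some eigenvalue of `S` with an eigenvector orthogonal to `C`. -/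
theorem exists_eigenvector_ge {κ : Type*} [Fintype κ] {T S : Matrix κ κ ℂ}
    (hS : S.IsHermitian) (hTS : (S - T).PosSemidef) (C : Set (κ → ℂ))
    (hC : ∀ c ∈ C, S *ᵥ c = c) {w : κ → ℂ} (hw : w ≠ 0) (hwC : ∀ c ∈ C, star c ⬝ᵥ w = 0)
    {r : ℝ} (hr : T *ᵥ w = (r : ℂ) • w) :
    ∃ r' : ℝ, r ≤ r' ∧ ∃ w' : κ → ℂ, w' ≠ 0 ∧ (∀ c ∈ C, star c ⬝ᵥ w' = 0) ∧
      S *ᵥ w' = (r' : ℂ) • w' := by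
  classical
  let P : Submodule ℂ (EuclideanSpace ℂ κ) :=
    { carrier := {v | ∀ c ∈ C, star c ⬝ᵥ v.ofLp = 0}
      add_mem' := fun {a b} ha hb c hc => by
        simp [dotProduct_add, ha c hc, hb c hc]
      zero_mem' := fun c _ => by simp
      smul_mem' := fun a v hv c hc => by simp [hv c hc] }
  let f : EuclideanSpace ℂ κ →ₗ[ℂ] EuclideanSpace ℂ κ := toEuclideanLin S
  have hf : ∀ v, (f v).ofLp = S *ᵥ v.ofLp := fun v => rfl
  have hP : ∀ v ∈ P, f v ∈ P := fun v hv c hc => by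
    have h : star c ᵥ* S = star c := by
      have := congrArg star (hC c hc)
      rwa [star_mulVec, hS] at this
    rw [hf, dotProduct_mulVec, h]
    exact hv c hc
  have hf₀ : f.IsSymmetric := isSymmetric_toEuclideanLin_iff.mpr hS
  have hsym := hf₀.restrict_invariant hP
  set g : P →ₗ[ℂ] P := f.restrict hP
  let w₀ : P := ⟨WithLp.toLp 2 w, hwC⟩
  have hw₀ : w₀ ≠ 0 := fun h => hw (by
    have := congrArg (fun v : P => v.1.ofLp) h
    exact this)
  suffices h : r * ‖w₀‖ ^ 2 ≤ RCLike.re (inner ℂ (g w₀) w₀) by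
    obtain ⟨r', hle, v, hv, hgv⟩ := exists_eigenvalue_ge_rayleigh hsym hw₀ h
    exact ⟨r', hle, v.1.ofLp, fun h => hv (Subtype.ext (WithLp.ofLp_injective 2 h)), v.2,
      congrArg (fun v : P => v.1.ofLp) hgv⟩
  have h1 : (inner ℂ (g w₀) w₀ : ℂ) = star w ⬝ᵥ S *ᵥ w := by
    rw [show (inner ℂ (g w₀) w₀ : ℂ) = w ⬝ᵥ star (S *ᵥ w) from rfl, star_mulVec, hS,
      dotProduct_comm, ← dotProduct_mulVec]
  have h2 : ((‖w₀‖ ^ 2 : ℝ) : ℂ) = star w ⬝ᵥ w := by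
    have := inner_self_eq_norm_sq_to_K (𝕜 := ℂ) w₀
    rw [show (inner ℂ w₀ w₀ : ℂ) = w ⬝ᵥ star w from rfl, dotProduct_comm] at this
    rw [this]
    simp
  have h3 := hTS.dotProduct_mulVec_nonneg w
  rw [sub_mulVec, dotProduct_sub, hr, dotProduct_smul, ← h2, ← h1, smul_eq_mul] at h3
  have h4 := (Complex.le_def.mp h3).1
  simp only [Complex.zero_re, Complex.sub_re, ← Complex.ofReal_mul, Complex.ofReal_re] at h4
  have h5 : RCLike.re (inner ℂ (g w₀) w₀ : ℂ) =
    (inner ℂ (g w₀) w₀ : ℂ).re := rfl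
  rw [h5]
  linarith

theorem finite_real_eigenvalues {κ : Type*} [Fintype κ] (T : Matrix κ κ ℂ) :
    {r : ℝ | ∃ w : κ → ℂ, w ≠ 0 ∧ T *ᵥ w = (r : ℂ) • w}.Finite := by
  refine Set.Finite.subset ((Module.End.finite_hasEigenvalue (mulVecLin T)).preimage
    Complex.ofReal_injective.injOn) ?_
  rintro r ⟨w, hw, h⟩
  exact Module.End.hasEigenvalue_of_hasEigenvector (x := w)
    ⟨Module.End.mem_eigenspace_iff.mpr h, hw⟩

/-! ### Moment operators on graphs -/

section Graph

variable {n : ℕ} {G : SimpleGraph (Fin n)}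

theorem ne_of_mem_edgePairs {e : Fin n × Fin n} (he : e ∈ edgePairs G) : e.1 ≠ e.2 := by
  classical
  exact (Finset.mem_filter.mp he).2.1.ne

theorem graphMoment_eq (U : Gate) : graphMoment 2 U G =
    ((edgePairs G).card : ℂ)⁻¹ • ∑ e ∈ edgePairs G, edgeMoment U e.1 e.2 := rfl

theorem isSelfAdjoint_inv_natCast (m : ℕ) : IsSelfAdjoint ((m : ℂ)⁻¹) := by
  simp [IsSelfAdjoint]

theorem inv_natCast_nonneg (m : ℕ) : (0 : ℂ) ≤ (m : ℂ)⁻¹ := by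
  rw [show ((m : ℂ)⁻¹) = (((m : ℝ)⁻¹ : ℝ) : ℂ) by push_cast; rfl]
  exact Complex.zero_le_real.mpr (by positivity)

theorem graphMoment_isHermitian {U : Gate} (hU : U ∈ unitaryGroup (Fin 2 × Fin 2) ℂ) :
    (graphMoment 2 U G).IsHermitian := by
  rw [graphMoment_eq]
  refine IsHermitian.smul ?_ (isSelfAdjoint_inv_natCast _)
  rw [IsHermitian, conjTranspose_sum]
  exact Finset.sum_congr rfl fun e _ => edgeMoment_isHermitian hU

theorem graphMoment_sub_posSemidef {U V : Gate} (h : gadgetMoment 2 V ≤ gadgetMoment 2 U) :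
    (graphMoment 2 U G - graphMoment 2 V G).PosSemidef := by
  rw [graphMoment_eq, graphMoment_eq, ← smul_sub, ← Finset.sum_sub_distrib]
  exact (posSemidef_sum _ fun e _ => edgeMoment_sub_posSemidef h).smul (inv_natCast_nonneg _)

theorem graphMoment_iSWAP_add_posSemidef (hm : (edgePairs G).card ≠ 0) :
    (graphMoment 2 iSWAP G + (1 / 3 : ℂ) • 1).PosSemidef := by
  have hm' : ((edgePairs G).card : ℂ) ≠ 0 := by exact_mod_cast hm
  have e : graphMoment 2 iSWAP G + (1 / 3 : ℂ) • 1 = ((edgePairs G).card : ℂ)⁻¹ •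
      ∑ e ∈ edgePairs G, (edgeMoment iSWAP e.1 e.2 + (1 / 3 : ℂ) • 1) := by
    rw [graphMoment_eq, Finset.sum_add_distrib, Finset.sum_const, smul_add,
      ← Nat.cast_smul_eq_nsmul ℂ, smul_smul, inv_mul_cancel₀ hm', one_smul]
  rw [e]
  exact (posSemidef_sum _ fun e _ => edgeMoment_iSWAP_add_posSemidef).smul (inv_natCast_nonneg _)

theorem graphMoment_mulVec_commutant {U : Gate} (hU : U ∈ unitaryGroup (Fin 2 × Fin 2) ℂ)
    (hm : (edgePairs G).card ≠ 0) {M} (hM : M ∈ commutant 2 (Fin n → Fin 2)) :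
    graphMoment 2 U G *ᵥ opVec M = opVec M := by
  have hm' : ((edgePairs G).card : ℂ) ≠ 0 := by exact_mod_cast hm
  rw [graphMoment_eq, smul_mulVec, sum_mulVec, Finset.sum_congr rfl fun e he =>
    edgeMoment_mulVec_of_commute (ne_of_mem_edgePairs he) hU fun V hV =>
      hM _ (onSites_mem (ne_of_mem_edgePairs he) hV), Finset.sum_const,
    ← Nat.cast_smul_eq_nsmul ℂ, smul_smul, inv_mul_cancel₀ hm', one_smul]

open Classical in
/-- The edges at the vertex `s`. -/
def edgesAt (G : SimpleGraph (Fin n)) (s : Fin n) : Finset (Fin n × Fin n) :=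
  (edgePairs G).filter fun e => s = e.1 ∨ s = e.2

theorem graphMoment_mulVec_flipOp {U : Gate} (hU : U ∈ unitaryGroup (Fin 2 × Fin 2) ℂ)
    (hm : (edgePairs G).card ≠ 0) (s : Fin n) :
    graphMoment 2 U G *ᵥ opVec (flipOp s) =
      ((1 - (edgesAt G s).card / (edgePairs G).card : ℝ) : ℂ) • opVec (flipOp s) := by
  classical
  have hm' : ((edgePairs G).card : ℂ) ≠ 0 := by exact_mod_cast hm
  have he : ∀ e ∈ edgePairs G, edgeMoment U e.1 e.2 *ᵥ opVec (flipOp s) =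
      (if s = e.1 ∨ s = e.2 then (0 : ℂ) else 1) • opVec (flipOp s) := fun e he => by
    split_ifs with h
    · rw [edgeMoment_mulVec_flipOp_of_mem (ne_of_mem_edgePairs he) hU h, zero_smul]
    · rw [not_or] at h
      rw [edgeMoment_mulVec_flipOp_of_ne (ne_of_mem_edgePairs he) hU h.1 h.2, one_smul]
  have hs : ∑ e ∈ edgePairs G, (if s = e.1 ∨ s = e.2 then (0 : ℂ) else 1) =
      (edgePairs G).card - (edgesAt G s).card := by
    have : ∀ e : Fin n × Fin n, (if s = e.1 ∨ s = e.2 then (0 : ℂ) else 1) =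
        1 - if s = e.1 ∨ s = e.2 then (1 : ℂ) else 0 := fun e => by split_ifs <;> simp
    simp only [this, Finset.sum_sub_distrib, Finset.sum_const, Finset.sum_boole, edgesAt]
    simp
  rw [graphMoment_eq, smul_mulVec, sum_mulVec, Finset.sum_congr rfl he, ← Finset.sum_smul, hs,
    smul_smul]
  congr 1
  push_cast
  field_simp

theorem edgePairs_card_ne_zero (hn : 2 ≤ n) (hG : G.Connected) : (edgePairs G).card ≠ 0 := by
  have h01 : (⟨0, by omega⟩ : Fin n) ≠ ⟨1, by omega⟩ := by simp
  obtain ⟨p⟩ := hG.preconnected ⟨0, by omega⟩ ⟨1, by omega⟩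
  have hadj : ∃ a b, G.Adj a b := by
    cases p with
    | cons h _ => exact ⟨_, _, h⟩
  obtain ⟨a, b, hab⟩ := hadj
  rw [Finset.card_ne_zero]
  rcases lt_or_gt_of_ne hab.ne with h | h
  · exact ⟨(a, b), by simp [edgePairs, h, hab]⟩
  · exact ⟨(b, a), by simp [edgePairs, h, hab.symm]⟩

/-- Some vertex of a graph on at least three vertices meets at most two thirds of the edges. -/
theorem exists_card_edgesAt_le (hn : 3 ≤ n) (G : SimpleGraph (Fin n)) :
    ∃ s, 3 * (edgesAt G s).card ≤ 2 * (edgePairs G).card := by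
  classical
  have hsum : ∑ s, (edgesAt G s).card = 2 * (edgePairs G).card := by
    simp only [edgesAt, Finset.card_filter]
    rw [Finset.sum_comm, mul_comm, ← smul_eq_mul, ← Finset.sum_const]
    refine Finset.sum_congr rfl fun e he => ?_
    have hne := ne_of_mem_edgePairs he
    rw [← Finset.card_filter]
    have : (Finset.univ.filter fun s => s = e.1 ∨ s = e.2) = {e.1, e.2} := by
      ext s; simp
    rw [this, Finset.card_pair hne]
  by_contra! h
  have h1 : ∑ _s : Fin n, (2 * (edgePairs G).card + 1) ≤ ∑ s, 3 * (edgesAt G s).card :=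
    Finset.sum_le_sum fun s _ => h s
  rw [← Finset.mul_sum, hsum, Finset.sum_const, Finset.card_univ, Fintype.card_fin,
    smul_eq_mul] at h1
  nlinarith

/-- A gadget whose two-qubit moment operator dominates that of `iSWAP` has the smaller gap. -/
theorem spectralGap_le {U : Gate} (hU : U ∈ unitaryGroup (Fin 2 × Fin 2) ℂ)
    (h : gadgetMoment 2 iSWAP ≤ gadgetMoment 2 U) (hn : 3 ≤ n) (hG : G.Connected) :
    spectralGap 2 (graphMoment 2 U G) ≤ spectralGap 2 (graphMoment 2 iSWAP G) := by
  have hm := edgePairs_card_ne_zero (by omega) hG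
  obtain ⟨s, hs⟩ := exists_card_edgesAt_le hn G
  set r₀ : ℝ := 1 - (edgesAt G s).card / (edgePairs G).card with hr₀
  have hr₀' : 1 / 3 ≤ r₀ := by
    have hm' : (0 : ℝ) < (edgePairs G).card := by positivity
    have hs' : 3 * ((edgesAt G s).card : ℝ) ≤ 2 * (edgePairs G).card := by exact_mod_cast hs
    have : ((edgesAt G s).card : ℝ) / (edgePairs G).card ≤ 2 / 3 := by
      rw [div_le_iff₀ hm']; linarith
    linarith
  have hbdd : ∀ V, BddAbove {r : ℝ | ∃ w, w ≠ 0 ∧ (∀ M ∈ commutant 2 (Fin n → Fin 2),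
      ∑ p, star (M p.1 p.2) * w p = 0) ∧ graphMoment 2 V G *ᵥ w = (r : ℂ) • w} := fun V => by
    refine ((finite_real_eigenvalues (graphMoment 2 V G)).subset ?_).bddAbove
    rintro r ⟨w, h1, -, h3⟩
    exact ⟨w, h1, h3⟩
  have hmem : ∃ w, w ≠ 0 ∧ (∀ M ∈ commutant 2 (Fin n → Fin 2),
      ∑ p, star (M p.1 p.2) * w p = 0) ∧ graphMoment 2 iSWAP G *ᵥ w = (r₀ : ℂ) • w :=
    ⟨opVec (flipOp s), opVec_flipOp_ne_zero s, fun _ hM => flipOp_orthogonal_commutant s hM,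
      graphMoment_mulVec_flipOp iSWAP_mem hm s⟩
  have h1 : lambdaTwo 2 (graphMoment 2 iSWAP G) ≤ lambdaTwo 2 (graphMoment 2 U G) := by
    refine csSup_le ⟨r₀, hmem⟩ ?_
    rintro r ⟨w, hw, hwC, hr⟩
    obtain ⟨r', hle, w', hw', hwC', hr'⟩ := exists_eigenvector_ge
      (graphMoment_isHermitian (G := G) hU) (graphMoment_sub_posSemidef h)
      (opVec '' commutant 2 (Fin n → Fin 2))
      (by
        rintro _ ⟨M, hM, rfl⟩
        exact graphMoment_mulVec_commutant hU hm hM) hw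
      (by
        rintro _ ⟨M, hM, rfl⟩
        exact hwC M hM) hr
    exact hle.trans (le_csSup (hbdd U)
      ⟨w', hw', fun M hM => hwC' _ (Set.mem_image_of_mem _ hM), hr'⟩)
  have h2 : r₀ ≤ lambdaTwo 2 (graphMoment 2 iSWAP G) := le_csSup (hbdd iSWAP) hmem
  have h3 : lambdaMin 2 (graphMoment 2 iSWAP G) ≤ r₀ :=
    csInf_le (finite_real_eigenvalues _).bddBelow
      (let ⟨w, h1, _, h3⟩ := hmem; ⟨w, h1, h3⟩)
  have h4 : -(1 / 3) ≤ lambdaMin 2 (graphMoment 2 iSWAP G) := by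
    refine le_csInf (let ⟨w, h1, _, h3⟩ := hmem; ⟨r₀, w, h1, h3⟩) ?_
    rintro r ⟨w, hw, hr⟩
    have hp := (graphMoment_iSWAP_add_posSemidef hm).dotProduct_mulVec_nonneg w
    rw [add_mulVec, smul_mulVec, one_mulVec, hr, ← add_smul, dotProduct_smul, smul_eq_mul] at hp
    have hw' : 0 < star w ⬝ᵥ w := dotProduct_star_self_pos_iff.mpr hw
    have h5 : 0 < (star w ⬝ᵥ w).re := (Complex.lt_def.mp hw').1
    have h6 := (Complex.le_def.mp hp).1
    rw [show (r : ℂ) + 1 / 3 = ((r + 1 / 3 : ℝ) : ℂ) by push_cast; rfl, Complex.re_ofReal_mul,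
      Complex.zero_re] at h6
    linarith [nonneg_of_mul_nonneg_left h6 h5]
  have h5 : |lambdaMin 2 (graphMoment 2 iSWAP G)| ≤ lambdaTwo 2 (graphMoment 2 iSWAP G) :=
    abs_le.mpr ⟨by linarith, by linarith⟩
  rw [spectralGap, spectralGap, max_eq_left h5]
  linarith [le_max_left (lambdaTwo 2 (graphMoment 2 U G)) |lambdaMin 2 (graphMoment 2 U G)|]

end Graph

end

end IronedGadget

open IronedGadget
theorem mainTheorem2 (U : Gate) (hU : U ∈ Matrix.unitaryGroup (Fin 2 × Fin 2) ℂ) :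
    -- the two-qubit second moment operator is Hermitian and never strictly below that of iSWAP
    (gadgetMoment 2 U).IsHermitian ∧
    ¬ gadgetMoment 2 U < gadgetMoment 2 iSWAP ∧
    (gadgetMoment 2 iSWAP ≤ gadgetMoment 2 U ∨
      (¬ gadgetMoment 2 iSWAP ≤ gadgetMoment 2 U ∧
        ¬ gadgetMoment 2 U ≤ gadgetMoment 2 iSWAP)) ∧
    -- the region where it is above that of iSWAP, in terms of any KAK coefficients of `U`
    ∀ kx ky kz : ℝ, HasKAK U kx ky kz →
      3 * (coeffA kx ky kz - 5 / 9) - 4 * (coeffC kx ky kz - 1 / 3) =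
        2 / 3 * (1 + Real.cos (4 * kx) + Real.cos (4 * ky) + Real.cos (4 * kz)) ∧
      (gadgetMoment 2 iSWAP ≤ gadgetMoment 2 U ↔
        0 ≤ 3 * (coeffA kx ky kz - 5 / 9) - 4 * (coeffC kx ky kz - 1 / 3)) ∧
      -- in this region iSWAP has the larger spectral gap, on every connected graph
      (0 ≤ 3 * (coeffA kx ky kz - 5 / 9) - 4 * (coeffC kx ky kz - 1 / 3) →
        ∀ (n : ℕ), 3 ≤ n → ∀ G : SimpleGraph (Fin n), G.Connected →
          (graphMoment 2 U G).IsHermitian ∧ (graphMoment 2 iSWAP G).IsHermitian ∧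
          spectralGap 2 (graphMoment 2 U G) ≤ spectralGap 2 (graphMoment 2 iSWAP G)) := by
  have hge : gadgetMoment 2 iSWAP ≤ gadgetMoment 2 U ↔ -2 ≤ chiralInvariant U := by
    rw [gadgetMoment_le_iff iSWAP_mem hU, chiralInvariant_iSWAP, singletInvariant_iSWAP]
    exact and_iff_left (Complex.normSq_nonneg _)
  have himp : gadgetMoment 2 U ≤ gadgetMoment 2 iSWAP →
      gadgetMoment 2 iSWAP ≤ gadgetMoment 2 U := fun h => by
    rw [gadgetMoment_le_iff hU iSWAP_mem, singletInvariant_iSWAP] at h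
    exact hge.mpr (neg_two_le_chiralInvariant hU (h.2.antisymm (Complex.normSq_nonneg _)))
  refine ⟨gadgetMoment_isHermitian hU, fun h => h.not_ge (himp h.le), ?_, ?_⟩
  · by_cases h : gadgetMoment 2 iSWAP ≤ gadgetMoment 2 U
    · exact Or.inl h
    · exact Or.inr ⟨h, fun h' => h (himp h')⟩
  · intro kx ky kz hk
    have hid : 3 * (coeffA kx ky kz - 5 / 9) - 4 * (coeffC kx ky kz - 1 / 3) =
        2 / 3 * (1 + Real.cos (4 * kx) + Real.cos (4 * ky) + Real.cos (4 * kz)) := by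
      unfold coeffA coeffC
      ring
    have hiff : gadgetMoment 2 iSWAP ≤ gadgetMoment 2 U ↔
        0 ≤ 3 * (coeffA kx ky kz - 5 / 9) - 4 * (coeffC kx ky kz - 1 / 3) := by
      rw [hge, hid, hk.chiralInvariant_eq]
      constructor <;> intro h <;> linarith
    exact ⟨hid, hiff, fun h n hn G hG => ⟨graphMoment_isHermitian hU,
      graphMoment_isHermitian iSWAP_mem, spectralGap_le hU (hiff.mpr h) hn hG⟩⟩
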